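/- For a real number $x$ let $\Vert x\Vert$ be its distance to the nearest integer. For $k\ge 1$ and $(\zeta_1,\dots,\zeta_k)\in\mathbb{R}^k$ let $\chi_k(\zeta_1,\dots,\zeta_k)\in[0,\infty]$ be the supremum of all $\nu>0$ such that for arbitrarily large real $X$ there are integers $x_1,\dots,x_k$ with $0<|x_j|\le X$ and $\Vert x_j\zeta_j\Vert\le X^{-\nu}$ for all $1\le j\le k$. For $\zeta\in\mathbb{R}$ let $\lambda_k(\zeta)$ be the supremum of all real $\mu$ such that $\max_{1\le j\le k}\Vert x\zeta^j\Vert\le x^{-\mu}$ has arbitrarily large integer solutions $x$. **Theorem.** Let $k\ge 1$ be an integer. For every $\lambda\in[2,\infty]$ a real transcendental $\zeta$ with $$\chi_k(\zeta,\zeta^2,\dots,\zeta^k)=\lambda_k(\zeta)=\lambda$$ can be explicitly constructed. Explicitly: (a) For every $\lambda\in[2,\infty]$ the number $\zeta=\sum_{n\ge 1}2^{-a_n}$, where $a_n=\lfloor (k(\lambda+1))^n\rfloor$ if $\lambda<\infty$ and $a_n=n!$ if $\lambda=\infty$, is transcendental and satisfies $\chi_k(\zeta,\zeta^2,\dots,\zeta^k)=\lambda_k(\zeta)=\lambda$.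 (b) Let $\lambda\in[2,\infty)$. For every sequence $\varepsilon=(\varepsilon_j)_{j\ge 2}$ with values in $\{0,1\}$ (in particular for $\varepsilon=0$), the continued fraction $\zeta=[0;a_1,a_2,\dots]$ with convergents $r_n/s_n$ and partial quotients $a_1=1$, $a_2=2$, $a_{j+1}=\lceil s_j^{k\lambda+k-2}\rceil+\varepsilon_j$ for $j\ge 2$ converges, the numbers $1,\zeta,\dots,\zeta^k$ are linearly independent over $\mathbb{Q}$, and $\chi_k(\zeta,\zeta^2,\dots,\zeta^k)=\lambda_k(\zeta)=\lambda$. For all but countably many sequences $\varepsilon$ the number $\zeta$ is transcendental. (c) In particular, the spectrum of $\chi_k$ on the Veronese curve, that is, the set of values $\chi_k(\zeta,\zeta^2,\dots,\zeta^k)$ over all $\zeta\in\mathbb{R}$ for which $1,\zeta,\dots,\zeta^k$ are linearly independent over $\mathbb{Q}$, contains $[2,\infty]$. -/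

import Mathlib

open Filter Topology

noncomputable section

namespace SimApprox

/-- The distance from a real number to the nearest integer. -/
def distInt (x : ℝ) : ℝ := |x - round x|

/-- The exponents `ν > 0` such that, for arbitrarily large real `X`, there are nonzero integers
`x_1, …, x_k` of absolute value at most `X` with `‖x_j ζ_j‖ ≤ X ^ (-ν)` for all `j`. -/
def chiSet {k : ℕ} (ζ : Fin k → ℝ) : Set ℝ :=
  {ν | 0 < ν ∧ ∀ X₀ : ℝ, ∃ X : ℝ, X₀ ≤ X ∧ ∃ x : Fin k → ℤ,
    (∀ j, 0 < |x j| ∧ ((|x j| : ℤ) : ℝ) ≤ X) ∧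
    ∀ j, distInt ((x j : ℝ) * ζ j) ≤ X ^ (-ν)}

/-- The exponent `χ_k(ζ_1, …, ζ_k)`, a supremum in the extended reals. -/
def chi {k : ℕ} (ζ : Fin k → ℝ) : EReal := sSup (Real.toEReal '' chiSet ζ)

/-- The real `μ` such that `max_{1 ≤ j ≤ k} ‖x ζ ^ j‖ ≤ x ^ (-μ)` has arbitrarily large integer
solutions `x`. -/
def lambdaSet (k : ℕ) (ζ : ℝ) : Set ℝ :=
  {μ | ∀ N : ℕ, ∃ x : ℤ, (N : ℤ) < x ∧
    ∀ j ∈ Finset.Icc 1 k, distInt ((x : ℝ) * ζ ^ j) ≤ (x : ℝ) ^ (-μ)}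

/-- The exponent `λ_k(ζ)`, a supremum in the extended reals. -/
def lambdaExp (k : ℕ) (ζ : ℝ) : EReal := sSup (Real.toEReal '' lambdaSet k ζ)

/-- The point `(ζ, ζ ^ 2, …, ζ ^ k)` of the Veronese curve. -/
def veronese (k : ℕ) (ζ : ℝ) : Fin k → ℝ := fun j => ζ ^ ((j : ℕ) + 1)

/-- `1, ζ_1, …, ζ_k` are linearly independent over `ℚ`. -/
def IndepWithOne {k : ℕ} (ζ : Fin k → ℝ) : Prop :=
  LinearIndependent ℚ (Fin.cons 1 ζ : Fin (k + 1) → ℝ)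

/-- The spectrum of `χ_k` on the Veronese curve: its values at the points of the curve whose
coordinates are linearly independent over `ℚ` together with `1`. -/
def veroneseSpectrum (k : ℕ) : Set EReal :=
  {w | ∃ ζ : ℝ, IndepWithOne (veronese k ζ) ∧ chi (veronese k ζ) = w}

/-- The exponents of the lacunary binary series: `⌊(k (l + 1)) ^ n⌋` for finite `l`,
and `n!` for `l = ∞`. -/
def binaryExponent (k : ℕ) (l : EReal) (n : ℕ) : ℕ :=
  if l = ⊤ then n.factorial else ⌊((k : ℝ) * (l.toReal + 1)) ^ n⌋₊

/-- The number `∑_{n ≥ 1} 2 ^ (-a_n)` with the exponents `a_n = binaryExponent k l n`. -/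
def binaryNumber (k : ℕ) (l : EReal) : ℝ :=
  ∑' n : ℕ, (1 / 2 : ℝ) ^ binaryExponent k l (n + 1)

/-- The denominators `s_0 = 1, s_1 = 1, s_2 = 3, s_{j+1} = a_{j+1} s_j + s_{j-1}` of the continued
fraction with partial quotients `a_1 = 1, a_2 = 2` and
`a_{j+1} = ⌈s_j ^ (k l + k - 2)⌉ + ε_{j-2}` for `j ≥ 2`. -/
def cfDen (k : ℕ) (l : ℝ) (ε : ℕ → Fin 2) : ℕ → ℕ
  | 0 => 1
  | 1 => 1
  | 2 => 3
  | n + 3 => (⌈(cfDen k l ε (n + 2) : ℝ) ^ ((k : ℝ) * l + k - 2)⌉₊ + (ε n : ℕ)) *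
      cfDen k l ε (n + 2) + cfDen k l ε (n + 1)

/-- The partial quotients `a_0 = 0, a_1 = 1, a_2 = 2` and
`a_{j+1} = ⌈s_j ^ (k l + k - 2)⌉ + ε_{j-2}` for `j ≥ 2`. -/
def cfQuot (k : ℕ) (l : ℝ) (ε : ℕ → Fin 2) : ℕ → ℕ
  | 0 => 0
  | 1 => 1
  | 2 => 2
  | n + 3 => ⌈(cfDen k l ε (n + 2) : ℝ) ^ ((k : ℝ) * l + k - 2)⌉₊ + (ε n : ℕ)

/-- The continued fraction `[a_0; a_1, a_2, …]` with `a_n = cfQuot k l ε n`. -/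
def cfFraction (k : ℕ) (l : ℝ) (ε : ℕ → Fin 2) : GenContFract ℝ where
  h := (cfQuot k l ε 0 : ℝ)
  s := Stream'.Seq.ofStream fun n => ⟨1, (cfQuot k l ε (n + 1) : ℝ)⟩

/-- The value of the continued fraction, the limit of its convergents. -/
def cfNumber (k : ℕ) (l : ℝ) (ε : ℕ → Fin 2) : ℝ :=
  limUnder atTop (cfFraction k l ε).convs

theorem cfFraction_get (k : ℕ) (l : ℝ) (ε : ℕ → Fin 2) (n : ℕ) :
    (cfFraction k l ε).s.get? n = some ⟨1, (cfQuot k l ε (n + 1) : ℝ)⟩ := rfl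

/-- The recursively defined `s_n` are the denominators of the convergents. -/
theorem cfFraction_dens (k : ℕ) (l : ℝ) (ε : ℕ → Fin 2) (n : ℕ) :
    (cfFraction k l ε).dens n = (cfDen k l ε n : ℝ) := by
  have h : ∀ n, (cfFraction k l ε).dens n = (cfDen k l ε n : ℝ) ∧
      (cfFraction k l ε).dens (n + 1) = (cfDen k l ε (n + 1) : ℝ) := by
    intro n
    induction n with
    | zero =>
      refine ⟨by simp [cfDen], ?_⟩
      rw [GenContFract.first_den_eq (cfFraction_get k l ε 0)]
      simp [cfDen, cfQuot]
    | succ n ih =>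
      refine ⟨ih.2, ?_⟩
      rw [GenContFract.dens_recurrence (cfFraction_get k l ε (n + 1)) ih.1 ih.2]
      cases n with
      | zero => norm_num [cfDen, cfQuot]
      | succ n => simp [cfDen, cfQuot]
  exact (h n).1

end SimApprox

end

namespace SimApprox

/-! Put `L = k (l + 1)`. Both constructions produce reduced fractions `p / q` with `|ζ - p / q|` of
exact order `q ^ (-L)` and consecutive denominators satisfying `q' ≪ q ^ L` (`IsApproxSeq`). The
integer `x = q ^ k` clears the denominators of all `(p / q) ^ j`, so `‖x ζ ^ j‖ ≪ q ^ (k - L) = x ^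
(-l)` and `λ_k ≥ l`. Equal `x_j` give `χ_k ≥ λ_k`.

The main point is `χ_k ≤ l` (`IsApproxSeq.le_of_mem_chiSet`). Suppose `ν > l` is admissible, with `Y
= X ^ ν` large, and choose consecutive denominators with `2 q < Y ≤ 2 q'`. Comparing `x_j ζ ^ j`
with the reduced fraction `p ^ j / q ^ j`, either `q ^ j` divides `x_j`, or `Y ≪ q ^ j`, or `X ≫ q ^
(L - j)`. Induction on `j` rules out the last two, using `ν > 2`. For `j = k` this gives `X ≥ q ^ k`
and `Y ≪ q ^ (L - k) = q ^ (k l)`, which contradicts `ν > l`.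

Since `L > k`, Liouville's inequality gives linear independence. Transcendence of the binary series
is elementary (`transcendental_of_doubling`): a polynomial relation, truncated, is a signed sum of
powers of `1 / 2`, in which an isolated cluster of terms with the leading coefficient cannot cancel.
For the continued fractions, distinct `ε` give distinct numbers and there are only countably many
algebraic numbers. -/

theorem distInt_le_abs_sub (x : ℝ) (m : ℤ) : distInt x ≤ |x - m| := round_le x m

/-- Taking all `x_j` equal, a positive exponent for `λ_k` is one for `χ_k`. -/
theorem mem_chiSet_of_mem_lambdaSet {k : ℕ} {ζ μ : ℝ} (hμ : 0 < μ) (h : μ ∈ lambdaSet k ζ) :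
    μ ∈ chiSet (veronese k ζ) := by
  refine ⟨hμ, fun X₀ => ?_⟩
  obtain ⟨N, hN⟩ := exists_nat_ge X₀
  obtain ⟨x, hx, hd⟩ := h N
  have hx0 : 0 < x := lt_of_le_of_lt (Int.natCast_nonneg N) hx
  refine ⟨x, hN.trans (by exact_mod_cast hx.le), fun _ => x, fun j => ?_, fun j => ?_⟩
  · simp [abs_of_pos hx0, hx0]
  · exact hd (j + 1) (Finset.mem_Icc.2 ⟨by omega, j.2⟩)

/-! ### Local comparison estimates -/

theorem eventually_abs_pow_sub_pow_le (k : ℕ) (ζ : ℝ) :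
    ∃ D : ℝ, 0 < D ∧ ∀ᶠ η in 𝓝 ζ, ∀ j ∈ Finset.Icc 1 k, |η ^ j - ζ ^ j| ≤ D * |η - ζ| := by
  have h : ∀ j : ℕ, ∃ D : ℝ, 0 < D ∧ ∀ᶠ η in 𝓝 ζ, |η ^ j - ζ ^ j| ≤ D * |η - ζ| := by
    intro j
    have := (differentiableAt_pow (𝕜 := ℝ) (x := ζ) j).isBigO_sub
    obtain ⟨D, hD, hb⟩ := this.exists_pos
    exact ⟨D, hD, by simpa [Real.norm_eq_abs] using hb.bound⟩
  choose D hD hb using h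
  refine ⟨∑ j ∈ Finset.range (k + 1), D j, Finset.sum_pos (fun j _ => hD j) (by simp), ?_⟩
  rw [Filter.eventually_all_finset]
  intro j hj
  filter_upwards [hb j] with η hη
  refine hη.trans (mul_le_mul_of_nonneg_right ?_ (abs_nonneg _))
  exact Finset.single_le_sum (fun i _ => (hD i).le)
    (Finset.mem_range.2 (by have := (Finset.mem_Icc.1 hj).2; omega))

/-- The derivative `j ζ ^ (j - 1)` does not vanish, so taking `j`-th powers near `ζ` shrinks
distances by at most a constant factor. This transfers the lower bound for `|p / q - ζ|` to powers.
-/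
theorem eventually_abs_sub_le_pow (k : ℕ) {ζ : ℝ} (hζ : ζ ≠ 0) :
    ∃ D : ℝ, 0 < D ∧ ∀ᶠ η in 𝓝 ζ, ∀ j ∈ Finset.Icc 1 k, |η - ζ| ≤ D * |η ^ j - ζ ^ j| := by
  have h : ∀ j : ℕ, ∃ D : ℝ, 0 < D ∧ (1 ≤ j → ∀ᶠ η in 𝓝 ζ, |η - ζ| ≤ D * |η ^ j - ζ ^ j|) := by
    intro j
    by_cases hj : 1 ≤ j
    · have hne : (j : ℝ) * ζ ^ (j - 1) ≠ 0 :=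
        mul_ne_zero (by exact_mod_cast (by omega : j ≠ 0)) (pow_ne_zero _ hζ)
      have := (hasDerivAt_pow j ζ).isTheta_sub hne
      obtain ⟨D, hD, hb⟩ := this.2.exists_pos
      have hb := hb.bound
      rw [prod_pure, eventually_map] at hb
      exact ⟨D, hD, fun _ => by simpa [Real.norm_eq_abs] using hb⟩
    · exact ⟨1, one_pos, fun h => absurd h hj⟩
  choose D hD hb using h
  refine ⟨∑ j ∈ Finset.range (k + 1), D j, Finset.sum_pos (fun j _ => hD j) (by simp), ?_⟩
  rw [Filter.eventually_all_finset]
  intro j hj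
  filter_upwards [hb j (Finset.mem_Icc.1 hj).1] with η hη
  refine hη.trans (mul_le_mul_of_nonneg_right ?_ (abs_nonneg _))
  exact Finset.single_le_sum (fun i _ => (hD i).le)
    (Finset.mem_range.2 (by have := (Finset.mem_Icc.1 hj).2; omega))

theorem eventually_mul_rpow_lt {q : ℕ → ℕ} (hq : Tendsto q atTop atTop) {α β : ℝ} (h : β < α)
    (K : ℝ) : ∀ᶠ n in atTop, K * (q n : ℝ) ^ β < (q n : ℝ) ^ α := by
  have hq' : Tendsto (fun n => (q n : ℝ)) atTop atTop := tendsto_natCast_atTop_atTop.comp hq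
  have := (tendsto_rpow_atTop (sub_pos.2 h)).comp hq'
  filter_upwards [this.eventually_gt_atTop K, hq'.eventually_gt_atTop 0] with n hn h0
  have h1 : (q n : ℝ) ^ α = (q n : ℝ) ^ (α - β) * (q n : ℝ) ^ β := by
    rw [← Real.rpow_add h0]; ring_nf
  rw [h1]
  exact mul_lt_mul_of_pos_right hn (Real.rpow_pos_of_pos h0 _)

/-! ### Lower bound for `λ_k` and linear independence -/

/-- A number approximable to order `k (l + 1)` has `λ_k ≥ l`. -/
theorem mem_lambdaSet_of_liouvilleWith {k : ℕ} (hk : 1 ≤ k) {l μ ζ : ℝ} (hl : 0 < l)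
    (h : LiouvilleWith (k * (l + 1)) ζ) (hμ : μ < l) : μ ∈ lambdaSet k ζ := by
  intro N
  have hk' : (1 : ℝ) ≤ k := by exact_mod_cast hk
  set L : ℝ := k * (l + 1) with hL
  have hL0 : 0 < L := by positivity
  obtain ⟨C, hC, hf⟩ := h.exists_pos
  obtain ⟨D, hD, hpow⟩ := eventually_abs_pow_sub_pow_le k ζ
  obtain ⟨δ, hδ, hball⟩ := Metric.eventually_nhds_iff.1 hpow
  have e1 := eventually_mul_rpow_lt (q := id) tendsto_id hL0 (C / δ)
  have e2 := eventually_mul_rpow_lt (q := id) tendsto_id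
    (show -(k * l) < -(k * μ) by nlinarith) (D * C)
  obtain ⟨n, ⟨hn1, m, hne, hlt⟩, hnN, e1, e2⟩ :=
    (hf.and_eventually ((eventually_gt_atTop N).and (e1.and e2))).exists
  have hn0 : (0 : ℝ) < n := by exact_mod_cast hn1
  simp only [id, Real.rpow_zero, mul_one] at e1 e2
  have hnL : 0 < (n : ℝ) ^ L := Real.rpow_pos_of_pos hn0 _
  have hclose : dist ((m : ℝ) / n) ζ < δ := by
    rw [dist_comm, Real.dist_eq]
    refine hlt.trans ?_
    rw [div_lt_iff₀ hδ] at e1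
    rw [div_lt_iff₀ hnL]
    linarith
  -- `n ^ k` is a common denominator of all `(m / n) ^ j` with `j ≤ k`.
  refine ⟨(n : ℤ) ^ k, ?_, fun j hj => ?_⟩
  · have h1 : n ≤ n ^ k := Nat.le_self_pow (by omega) n
    exact_mod_cast lt_of_lt_of_le hnN h1
  · have hj' := Finset.mem_Icc.1 hj
    have hb := hball hclose j hj
    refine (distInt_le_abs_sub _ ((n : ℤ) ^ (k - j) * m ^ j)).trans ?_
    have heq : (((n : ℤ) ^ k : ℤ) : ℝ) * ζ ^ j - (((n : ℤ) ^ (k - j) * m ^ j : ℤ) : ℝ)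
        = -((n : ℝ) ^ k * (((m : ℝ) / n) ^ j - ζ ^ j)) := by
      have : (n : ℝ) ^ k = (n : ℝ) ^ (k - j) * (n : ℝ) ^ j := by
        rw [← pow_add]; congr 1; omega
      push_cast
      rw [div_pow, this]
      field_simp
      ring
    rw [heq, abs_neg, abs_mul, abs_of_pos (by positivity : (0 : ℝ) < (n : ℝ) ^ k)]
    have h1 : |(m : ℝ) / n - ζ| ≤ C * (n : ℝ) ^ (-L) := by
      rw [abs_sub_comm, Real.rpow_neg hn0.le, ← div_eq_mul_inv]
      exact hlt.le
    have h2 : (n : ℝ) ^ k * (n : ℝ) ^ (-L) = (n : ℝ) ^ (-(k * l)) := by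
      rw [← Real.rpow_natCast, ← Real.rpow_add hn0]
      congr 1; rw [hL]; ring
    have h3 : (((n : ℤ) ^ k : ℤ) : ℝ) ^ (-μ) = (n : ℝ) ^ (-(k * μ)) := by
      push_cast
      rw [← Real.rpow_natCast, ← Real.rpow_mul hn0.le]
      congr 1; ring
    rw [h3]
    calc (n : ℝ) ^ k * |((m : ℝ) / n) ^ j - ζ ^ j|
        ≤ (n : ℝ) ^ k * (D * (C * (n : ℝ) ^ (-L))) := by
          gcongr
          exact hb.trans (by gcongr)
      _ = D * C * ((n : ℝ) ^ k * (n : ℝ) ^ (-L)) := by ring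
      _ ≤ _ := by rw [h2]; exact e2.le

/-- The numbers `1, ζ, …, ζ ^ k` are independent if `ζ` is approximable to an order above `k`. -/
theorem indepWithOne_of_liouvilleWith {k : ℕ} (hk : 1 ≤ k) {p ζ : ℝ} (hp : k < p)
    (h : LiouvilleWith p ζ) : IndepWithOne (veronese k ζ) := by
  have hk' : (1 : ℝ) ≤ k := by exact_mod_cast hk
  have hirr : Irrational ζ := h.irrational (by linarith)
  have hcons : (Fin.cons 1 (veronese k ζ) : Fin (k + 1) → ℝ) = fun i : Fin (k + 1) => ζ ^ (i : ℕ) := by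
    funext i
    refine Fin.cases ?_ (fun j => ?_) i <;> simp [veronese]
  rw [IndepWithOne, hcons, ← LinearIndependent.iff_fractionRing ℤ ℚ, Fintype.linearIndependent_iff]
  intro g hg
  by_contra! hne
  obtain ⟨i, hi⟩ := hne
  set f : Polynomial ℤ := ∑ i : Fin (k + 1), Polynomial.monomial (i : ℕ) (g i) with hf
  have hcoef : f.coeff i = g i := by
    rw [hf, Polynomial.finsetSum_coeff, Finset.sum_eq_single i]
    · simp
    · intro j _ hj
      rw [Polynomial.coeff_monomial, if_neg (fun h => hj (Fin.ext h))]
    · simp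
  have f0 : f ≠ 0 := fun h0 => hi (by rw [← hcoef, h0, Polynomial.coeff_zero])
  have fdeg : f.natDegree ≤ k := by
    refine Polynomial.natDegree_sum_le_of_forall_le _ _ fun j _ => ?_
    exact (Polynomial.natDegree_monomial_le _).trans (by omega)
  have fa : Polynomial.eval ζ (Polynomial.map (algebraMap ℤ ℝ) f) = 0 := by
    rw [hf, Polynomial.map_sum, Polynomial.eval_finsetSum]
    simpa [zsmul_eq_mul] using hg
  -- Liouville's inequality bounds the distance to fractions of denominator `n` below by a multiple
  -- of `n ^ (-k)`, against approximation of order `p > k`.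
  obtain ⟨A, hA, hbound⟩ := Liouville.exists_pos_real_of_irrational_root hirr f0 fa
  obtain ⟨C, hC, hfr⟩ := h.exists_pos
  have e1 := eventually_mul_rpow_lt (q := id) tendsto_id hp (C * A)
  obtain ⟨n, ⟨hn1, m, -, hlt⟩, e1⟩ := (hfr.and_eventually e1).exists
  have hn0 : (0 : ℝ) < n := by exact_mod_cast hn1
  have hn1' : (1 : ℝ) ≤ n := by exact_mod_cast hn1
  have hb := hbound m (n - 1)
  have hcast : (((n - 1 : ℕ) : ℝ) + 1) = n := by
    have : n - 1 + 1 = n := by omega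
    exact_mod_cast this
  rw [hcast] at hb
  have hnp : 0 < (n : ℝ) ^ p := Real.rpow_pos_of_pos hn0 _
  have h1 : (n : ℝ) ^ f.natDegree ≤ (n : ℝ) ^ (k : ℝ) := by
    rw [Real.rpow_natCast]; exact pow_le_pow_right₀ hn1' fdeg
  have h2 : (1 : ℝ) ≤ (n : ℝ) ^ (k : ℝ) * (C / (n : ℝ) ^ p * A) := by
    refine hb.trans ?_
    gcongr
  simp only [id] at e1
  have h3 : (n : ℝ) ^ (k : ℝ) * (C / (n : ℝ) ^ p * A) = C * A * (n : ℝ) ^ (k : ℝ) / (n : ℝ) ^ p := by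
    ring
  rw [h3, le_div_iff₀ hnp] at h2
  linarith

/-! ### Approximation sequences and the upper bound for `χ_k` -/

/-- A sequence of reduced fractions whose distance from `ζ` is of the exact order `q_n ^ (-L)`,
with denominators growing at most like `q_{n+1} ≪ q_n ^ L`. -/
structure IsApproxSeq (L ζ : ℝ) (p : ℕ → ℤ) (q : ℕ → ℕ) : Prop where
  coprime : ∀ n, IsCoprime (p n) (q n : ℤ)
  tendsto : Tendsto q atTop atTop
  bounds : ∃ C : ℝ, 0 < C ∧ ∀ᶠ n in atTop, |(p n : ℝ) / q n - ζ| ≤ C * (q n : ℝ) ^ (-L) ∧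
    (q n : ℝ) ^ (-L) ≤ C * |(p n : ℝ) / q n - ζ| ∧ (q (n + 1) : ℝ) ≤ C * (q n : ℝ) ^ L

theorem IsApproxSeq.liouvilleWith {L ζ : ℝ} {p : ℕ → ℤ} {q : ℕ → ℕ} (h : IsApproxSeq L ζ p q) :
    LiouvilleWith L ζ := by
  obtain ⟨C, hC, hb⟩ := h.bounds
  refine ⟨C + 1, h.tendsto.frequently (Eventually.frequently ?_)⟩
  filter_upwards [hb, h.tendsto.eventually_gt_atTop 0] with n hn hq
  have hq0 : (0 : ℝ) < q n := by exact_mod_cast hq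
  have hqL : 0 < (q n : ℝ) ^ L := Real.rpow_pos_of_pos hq0 _
  have hqL' : 0 < (q n : ℝ) ^ (-L) := Real.rpow_pos_of_pos hq0 _
  refine ⟨p n, fun he => ?_, ?_⟩
  · have := hn.2.1
    rw [he, sub_self, abs_zero, mul_zero] at this
    linarith
  · rw [abs_sub_comm, div_eq_mul_inv (C + 1), ← Real.rpow_neg hq0.le]
    nlinarith [hn.1]

/-- With `y` the integer nearest to `x α`, the integer `y Q - x P` is either nonzero, hence at least
1 in absolute value, or zero. In the latter case coprimality forces `Q ∣ x`, and the error is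
exactly `|x| |P / Q - α|`. -/
theorem one_le_or_of_distInt_le {α X Z E₁ E₂ : ℝ} {x P : ℤ} {Q : ℕ} (hx : 0 < |x|)
    (hX : ((|x| : ℤ) : ℝ) ≤ X) (hPQ : IsCoprime P (Q : ℤ)) (hQ : 0 < Q)
    (hZ : distInt (x * α) ≤ Z) (h₁ : E₁ ≤ |(P : ℝ) / Q - α|) (h₂ : |(P : ℝ) / Q - α| ≤ E₂)
    (hE₁ : 0 ≤ E₁) :
    1 ≤ Q * Z + X * Q * E₂ ∨ ((Q : ℝ) ≤ X ∧ Q * E₁ ≤ Z) := by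
  set y := round ((x : ℝ) * α) with hy
  have hQ0 : (0 : ℝ) < Q := by exact_mod_cast hQ
  have hZ' : |(x : ℝ) * α - y| ≤ Z := hZ
  have hE₂ : 0 ≤ E₂ := (abs_nonneg _).trans h₂
  by_cases he : x * P = y * Q
  · right
    have hdvd : (Q : ℤ) ∣ x := hPQ.symm.dvd_of_dvd_mul_right ⟨y, by rw [he]; ring⟩
    have hle : (Q : ℤ) ≤ |x| := Int.le_of_dvd hx ((dvd_abs _ _).2 hdvd)
    have hle' : (Q : ℝ) ≤ ((|x| : ℤ) : ℝ) := by exact_mod_cast hle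
    refine ⟨hle'.trans hX, ?_⟩
    have hyR : (y : ℝ) = x * (P / Q) := by
      have : (x : ℝ) * P = y * Q := by exact_mod_cast he
      field_simp
      linarith
    have : |(x : ℝ) * α - y| = ((|x| : ℤ) : ℝ) * |(P : ℝ) / Q - α| := by
      rw [hyR, ← mul_sub, abs_mul, abs_sub_comm, Int.cast_abs]
    rw [this] at hZ'
    exact (mul_le_mul hle' h₁ hE₁ (hQ0.le.trans hle')).trans hZ'
  · left
    have h1 : (1 : ℤ) ≤ |y * Q - x * P| := Int.one_le_abs (sub_ne_zero.2 (Ne.symm he))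
    have h1' : (1 : ℝ) ≤ |(y : ℝ) * Q - x * P| := by exact_mod_cast h1
    have h2 : (y : ℝ) * Q - x * P = -(Q * (x * α - y)) + -(x * Q * (P / Q - α)) := by
      field_simp
      ring
    rw [h2] at h1'
    refine h1'.trans ((abs_add_le _ _).trans ?_)
    rw [abs_neg, abs_neg, abs_mul, abs_mul, abs_mul, abs_of_pos hQ0, ← Int.cast_abs]
    have hX0 : 0 ≤ X := le_trans (by exact_mod_cast hx.le) hX
    gcongr

theorem IsApproxSeq.tendsto_div {L ζ : ℝ} {p : ℕ → ℤ} {q : ℕ → ℕ} (h : IsApproxSeq L ζ p q)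
    (hL : 0 < L) : Tendsto (fun n => (p n : ℝ) / q n) atTop (𝓝 ζ) := by
  obtain ⟨C, hC, hb⟩ := h.bounds
  rw [tendsto_iff_dist_tendsto_zero]
  have h1 : Tendsto (fun n => C * (q n : ℝ) ^ (-L)) atTop (𝓝 (C * 0)) :=
    ((tendsto_rpow_neg_atTop hL).comp (tendsto_natCast_atTop_atTop.comp h.tendsto)).const_mul C
  rw [mul_zero] at h1
  refine squeeze_zero' (Eventually.of_forall fun _ => dist_nonneg) ?_ h1
  filter_upwards [hb] with n hn
  exact hn.1

/-- Exact approximation order `k (l + 1)` bounds `χ_k` by `l`. -/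
theorem IsApproxSeq.le_of_mem_chiSet {k : ℕ} (hk : 1 ≤ k) {l ζ ν : ℝ} (hl : 2 ≤ l)
    {p : ℕ → ℤ} {q : ℕ → ℕ} (h : IsApproxSeq (k * (l + 1)) ζ p q)
    (hν : ν ∈ chiSet (veronese k ζ)) : ν ≤ l := by
  by_contra! hlν
  have hk' : (1 : ℝ) ≤ k := by exact_mod_cast hk
  have hζ : ζ ≠ 0 := by
    have := h.liouvilleWith.ne_cast_int (by nlinarith) 0
    simpa using this
  set L : ℝ := k * (l + 1) with hL
  have hL3 : 3 ≤ L := by nlinarith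
  obtain ⟨C₀, hC₀, hb⟩ := h.bounds
  obtain ⟨D₁, hD₁, hp₁⟩ := eventually_abs_pow_sub_pow_le k ζ
  obtain ⟨D₂, hD₂, hp₂⟩ := eventually_abs_sub_le_pow k hζ
  have htd := h.tendsto_div (by linarith)
  obtain ⟨C, hC1, hCC, hCD₁, hCD₂⟩ :
      ∃ C : ℝ, 1 ≤ C ∧ C₀ ≤ C ∧ C₀ * D₁ ≤ C ∧ C₀ * D₂ ≤ C :=
    ⟨1 + C₀ + C₀ * D₁ + C₀ * D₂, by nlinarith [mul_pos hC₀ hD₁, mul_pos hC₀ hD₂],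
      by nlinarith [mul_pos hC₀ hD₁, mul_pos hC₀ hD₂],
      by nlinarith [mul_pos hC₀ hD₁, mul_pos hC₀ hD₂],
      by nlinarith [mul_pos hC₀ hD₁, mul_pos hC₀ hD₂]⟩
  -- The four comparisons `e1`–`e4` are the eventual contradictions used below. `e2`, which needs `j
  -- ν > j + 1` already for `j = 1`, is where `l ≥ 2` is sharp.
  have e1 := eventually_mul_rpow_lt h.tendsto (show L < (L - 1) * ν by nlinarith)
    ((2 * C) ^ ν * (2 * C))
  have e2 : ∀ᶠ n in atTop, ∀ j ∈ Finset.Icc 1 k,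
      2 * (q n : ℝ) ^ ((j : ℝ) + 1) < (q n : ℝ) ^ ((j : ℝ) * ν) := by
    rw [Filter.eventually_all_finset]
    intro j hj
    have hj1 : (1 : ℝ) ≤ j := by exact_mod_cast (Finset.mem_Icc.1 hj).1
    exact eventually_mul_rpow_lt h.tendsto (by nlinarith) 2
  have e3 := eventually_mul_rpow_lt h.tendsto (show L - 1 < (L - k) * ν by
    have : L - k = k * l := by rw [hL]; ring
    rw [this]
    have : (k : ℝ) * l * 2 ≤ k * l * ν := by gcongr; linarith
    nlinarith) ((2 * C) ^ ν * C)
  have e4 := eventually_mul_rpow_lt h.tendsto (show L - k < k * ν by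
    rw [hL]; nlinarith) C
  obtain ⟨n₀, hn₀⟩ := eventually_atTop.1 (hb.and ((htd.eventually hp₁).and ((htd.eventually hp₂).and
    ((h.tendsto.eventually_gt_atTop 0).and (e1.and (e2.and (e3.and e4)))))))
  obtain ⟨hν0, hν⟩ := hν
  obtain ⟨X, hX, x, hxX, hxd⟩ := hν (2 * q n₀ + 1)
  have hX1 : 1 ≤ X := le_trans (by linarith [Nat.cast_nonneg (α := ℝ) (q n₀)]) hX
  have hX0 : 0 < X := by linarith
  set Y := X ^ ν with hY
  have hY0 : 0 < Y := Real.rpow_pos_of_pos hX0 _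
  have hXY : X ≤ Y := by
    calc X = X ^ (1 : ℝ) := (Real.rpow_one X).symm
      _ ≤ X ^ ν := Real.rpow_le_rpow_of_exponent_le hX1 (by linarith)
  -- Such an `n` exists because `Y ≥ X > 2 q n₀` while `q` is unbounded.
  obtain ⟨n, hn, hlow, hup⟩ : ∃ n, n₀ ≤ n ∧ 2 * (q n : ℝ) < Y ∧ Y ≤ 2 * q (n + 1) := by
    by_contra! hcon
    have hall : ∀ n, n₀ ≤ n → 2 * (q n : ℝ) < Y := by
      intro n hn
      induction n, hn using Nat.le_induction with
      | base => linarith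
      | succ n hn ih => exact hcon n hn ih
    obtain ⟨n, hn1, hn2⟩ := ((eventually_ge_atTop n₀).and
      ((tendsto_natCast_atTop_atTop.comp h.tendsto).eventually_ge_atTop Y)).exists
    have := hall n hn1
    simp only [Function.comp] at hn2
    linarith
  obtain ⟨⟨hb1, hb2, hb3⟩, hp1, hp2, hq0, e1, e2, e3, e4⟩ := hn₀ n hn
  have hqR : (0 : ℝ) < q n := by exact_mod_cast hq0
  have hq1 : (1 : ℝ) ≤ q n := by exact_mod_cast hq0
  set Q : ℝ := (q n : ℝ) with hQ
  have hupY : Y ≤ 2 * C * Q ^ L := by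
    have : C₀ * Q ^ L ≤ C * Q ^ L := by gcongr
    linarith
  -- the three cases for the exponent `j`
  have tri : ∀ j ∈ Finset.Icc 1 k, Y ≤ 2 * Q ^ (j : ℝ) ∨ Q ^ (L - j) ≤ 2 * C * X ∨
      (Q ^ (j : ℝ) ≤ X ∧ Y ≤ C * Q ^ (L - j)) := by
    intro j hj
    have hj' := Finset.mem_Icc.1 hj
    have hxj := hxX ⟨j - 1, by omega⟩
    have hdj := hxd ⟨j - 1, by omega⟩
    have hv : veronese k ζ ⟨j - 1, by omega⟩ = ζ ^ j := by
      simp only [veronese]; congr 1; omega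
    rw [hv] at hdj
    have hcast : ((p n ^ j : ℤ) : ℝ) / ((q n ^ j : ℕ) : ℝ) = ((p n : ℝ) / Q) ^ j := by
      push_cast; rw [div_pow]
    have hU : |((p n ^ j : ℤ) : ℝ) / ((q n ^ j : ℕ) : ℝ) - ζ ^ j| ≤ C * Q ^ (-L) := by
      rw [hcast]
      calc _ ≤ D₁ * |(p n : ℝ) / Q - ζ| := hp1 j hj
        _ ≤ D₁ * (C₀ * Q ^ (-L)) := by gcongr
        _ = C₀ * D₁ * Q ^ (-L) := by ring
        _ ≤ _ := by gcongr
    have hLo : Q ^ (-L) / C ≤ |((p n ^ j : ℤ) : ℝ) / ((q n ^ j : ℕ) : ℝ) - ζ ^ j| := by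
      rw [hcast, div_le_iff₀ (by linarith)]
      calc Q ^ (-L) ≤ C₀ * |(p n : ℝ) / Q - ζ| := hb2
        _ ≤ C₀ * (D₂ * |((p n : ℝ) / Q) ^ j - ζ ^ j|) := by
          gcongr; exact hp2 j hj
        _ = C₀ * D₂ * |((p n : ℝ) / Q) ^ j - ζ ^ j| := by ring
        _ ≤ C * |((p n : ℝ) / Q) ^ j - ζ ^ j| := by gcongr
        _ = _ := by ring
    have hQj : ((q n ^ j : ℕ) : ℝ) = Q ^ (j : ℝ) := by
      rw [Real.rpow_natCast]; push_cast; rfl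
    have hYi : X ^ (-ν) = Y⁻¹ := Real.rpow_neg hX0.le _
    have hsplit : Q ^ (j : ℝ) * Q ^ (-L) = (Q ^ (L - j))⁻¹ := by
      rw [← Real.rpow_add hqR, ← Real.rpow_neg hqR.le]; congr 1; ring
    have hQLj : 0 < Q ^ (L - j) := Real.rpow_pos_of_pos hqR _
    have := one_le_or_of_distInt_le hxj.1 hxj.2
      (P := p n ^ j) (Q := q n ^ j) (by push_cast; exact (h.coprime n).pow) (by positivity) hdj hLo hU
      (by positivity)
    rw [hQj, hYi] at this
    rcases this with h1 | ⟨h1, h2⟩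
    -- Of the two summands adding up to at least 1, one is at least `1 / 2`.
    · by_cases hA : Y ≤ 2 * Q ^ (j : ℝ)
      · exact Or.inl hA
      · right; left
        push Not at hA
        have h3 : Q ^ (j : ℝ) * Y⁻¹ < 1 / 2 := by
          rw [← div_eq_mul_inv, div_lt_iff₀ hY0]; linarith
        have h4 : X * Q ^ (j : ℝ) * (C * Q ^ (-L)) = C * X / Q ^ (L - j) := by
          rw [div_eq_mul_inv, ← hsplit]; ring
        rw [h4] at h1
        have h5 : 1 / 2 ≤ C * X / Q ^ (L - j) := by linarith
        rw [le_div_iff₀ hQLj] at h5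
        linarith
    · right; right
      refine ⟨h1, ?_⟩
      have h4 : Q ^ (j : ℝ) * (Q ^ (-L) / C) = (C * Q ^ (L - j))⁻¹ := by
        rw [mul_inv, ← hsplit]; ring
      rw [h4] at h2
      exact (inv_le_inv₀ (by positivity) hY0).1 h2
  have mulrpow : ∀ {a : ℝ}, Q ^ a ≤ 2 * C * X → Q ^ (a * ν) ≤ (2 * C) ^ ν * Y := by
    intro a ha
    rw [Real.rpow_mul hqR.le, hY, ← Real.mul_rpow (by linarith) hX0.le]
    exact Real.rpow_le_rpow (by positivity) ha hν0.le
  have h2C : 0 < (2 * C) ^ ν := by positivity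
  have base : Q ≤ X ∧ Y ≤ C * Q ^ (L - 1) := by
    have := tri 1 (Finset.mem_Icc.2 ⟨le_rfl, hk⟩)
    simp only [Nat.cast_one, Real.rpow_one] at this
    rcases this with h1 | h1 | h1
    · linarith
    -- Raising to the power `ν` gives `Q ^ ((L - 1) ν) ≪ Y ≪ Q ^ L`, against `e1`.
    · have h2 := mulrpow h1
      have h3 : (2 * C) ^ ν * Y ≤ (2 * C) ^ ν * (2 * C * Q ^ L) := by gcongr
      linarith
    · exact h1
  have key : ∀ j, 1 ≤ j → j ≤ k → Q ^ (j : ℝ) ≤ X ∧ Y ≤ C * Q ^ (L - j) := by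
    intro j hj
    induction j, hj using Nat.le_induction with
    | base => intro _; simpa using base
    | succ j hj ih =>
      intro hjk
      have ih := ih (by omega)
      rcases tri (j + 1) (Finset.mem_Icc.2 ⟨by omega, hjk⟩) with h1 | h1 | h1
      -- The previous divisibility gave `X ≥ Q ^ j`, so `Q ^ (j ν) ≤ Y ≤ 2 Q ^ (j + 1)`, against
      -- `e2`.
      · have h2 := e2 j (Finset.mem_Icc.2 ⟨hj, by omega⟩)
        have h3 : Q ^ ((j : ℝ) * ν) ≤ Y := by
          rw [Real.rpow_mul hqR.le]
          exact Real.rpow_le_rpow (by positivity) ih.1 hν0.le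
        push_cast at h1
        linarith
      -- Here the bound `Y ≪ Q ^ (L - 1)` from `j = 1` is needed; the choice of `n` only gives `Y ≪
      -- Q ^ L`.
      · have hjk' : ((j + 1 : ℕ) : ℝ) ≤ k := by exact_mod_cast hjk
        have h2 : Q ^ (L - k) ≤ 2 * C * X :=
          (Real.rpow_le_rpow_of_exponent_le hq1 (by linarith)).trans h1
        have h3 := mulrpow h2
        have h4 : (2 * C) ^ ν * Y ≤ (2 * C) ^ ν * (C * Q ^ (L - 1)) := by
          gcongr; exact base.2
        linarith
      · exact h1
  have hfin := key k hk le_rfl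
  have h3 : Q ^ ((k : ℝ) * ν) ≤ Y := by
    rw [Real.rpow_mul hqR.le]
    exact Real.rpow_le_rpow (by positivity) hfin.1 hν0.le
  linarith [hfin.2]

/-! ### Values of the two exponents -/

theorem le_lambdaExp_of_liouvilleWith {k : ℕ} (hk : 1 ≤ k) {l ζ : ℝ} (hl : 0 < l)
    (h : LiouvilleWith (k * (l + 1)) ζ) : (l : EReal) ≤ lambdaExp k ζ := by
  refine EReal.ge_of_forall_gt_iff_ge.1 fun μ hμ => ?_
  exact le_sSup ⟨μ, mem_lambdaSet_of_liouvilleWith hk hl h (EReal.coe_lt_coe_iff.1 hμ), rfl⟩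

/-- `chiSet` admits only positive exponents, so smaller members of `lambdaSet` are dominated by one
positive member. -/
theorem lambdaExp_le_chi {k : ℕ} {ζ : ℝ} (h : 0 < lambdaExp k ζ) :
    lambdaExp k ζ ≤ chi (veronese k ζ) := by
  obtain ⟨_, ⟨μ₀, hμ₀, rfl⟩, hpos⟩ := lt_sSup_iff.1 h
  have hpos : 0 < μ₀ := EReal.coe_pos.1 hpos
  refine sSup_le ?_
  rintro _ ⟨μ, hμ, rfl⟩
  rcases le_or_gt μ μ₀ with hle | hlt
  · exact (EReal.coe_le_coe_iff.2 hle).trans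
      (le_sSup ⟨μ₀, mem_chiSet_of_mem_lambdaSet hpos hμ₀, rfl⟩)
  · exact le_sSup ⟨μ, mem_chiSet_of_mem_lambdaSet (hpos.trans hlt) hμ, rfl⟩

theorem IsApproxSeq.exponents_eq {k : ℕ} (hk : 1 ≤ k) {l ζ : ℝ} (hl : 2 ≤ l)
    {p : ℕ → ℤ} {q : ℕ → ℕ} (h : IsApproxSeq (k * (l + 1)) ζ p q) :
    IndepWithOne (veronese k ζ) ∧ chi (veronese k ζ) = (l : EReal) ∧ lambdaExp k ζ = (l : EReal) := by
  have hk' : (1 : ℝ) ≤ k := by exact_mod_cast hk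
  have hchi : chi (veronese k ζ) ≤ l := by
    refine sSup_le ?_
    rintro _ ⟨ν, hν, rfl⟩
    exact EReal.coe_le_coe_iff.2 (h.le_of_mem_chiSet hk hl hν)
  have hlam : (l : EReal) ≤ lambdaExp k ζ :=
    le_lambdaExp_of_liouvilleWith hk (by linarith) h.liouvilleWith
  have hle : lambdaExp k ζ ≤ chi (veronese k ζ) :=
    lambdaExp_le_chi (lt_of_lt_of_le (EReal.coe_pos.2 (by linarith)) hlam)
  exact ⟨indepWithOne_of_liouvilleWith hk (by nlinarith) h.liouvilleWith,
    le_antisymm hchi (hlam.trans hle), le_antisymm (hle.trans hchi) hlam⟩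

theorem exponents_eq_top {k : ℕ} (hk : 1 ≤ k) {ζ : ℝ} (h : Liouville ζ) :
    IndepWithOne (veronese k ζ) ∧ chi (veronese k ζ) = ⊤ ∧ lambdaExp k ζ = ⊤ := by
  have htop : lambdaExp k ζ = ⊤ := by
    refine EReal.eq_top_iff_forall_lt _ |>.2 fun y => ?_
    refine lt_of_lt_of_le (EReal.coe_lt_coe_iff.2 ?_)
      (le_lambdaExp_of_liouvilleWith hk (l := |y| + 1) (by positivity) (h.liouvilleWith _))
    linarith [le_abs_self y]
  refine ⟨indepWithOne_of_liouvilleWith hk (lt_add_one (k : ℝ)) (h.liouvilleWith _), ?_, htop⟩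
  have := lambdaExp_le_chi (k := k) (ζ := ζ) (by rw [htop]; exact EReal.zero_lt_top)
  rw [htop] at this
  exact top_le_iff.1 this

/-! ### Lacunary binary series -/

section Lacunary

variable {a : ℕ → ℕ}

theorem add_le_of_doubling (h0 : 1 ≤ a 0) (ha : ∀ n, 2 * a n ≤ a (n + 1)) (n i : ℕ) :
    a n + i ≤ a (n + i) := by
  have hpos : ∀ n, 1 ≤ a n := fun n => by
    induction n with
    | zero => exact h0
    | succ n ih => have := ha n; omega
  induction i with
  | zero => rfl
  | succ i ih => have := ha (n + i); have := hpos (n + i); rw [← add_assoc n]; omega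

theorem two_pow_mul_le_of_doubling (ha : ∀ n, 2 * a n ≤ a (n + 1)) (n i : ℕ) :
    2 ^ i * a n ≤ a (n + i) := by
  induction i with
  | zero => simp
  | succ i ih => have := ha (n + i); rw [← add_assoc n, pow_succ]; nlinarith

theorem summable_of_doubling (h0 : 1 ≤ a 0) (ha : ∀ n, 2 * a n ≤ a (n + 1)) :
    Summable fun n => (1 / 2 : ℝ) ^ a n := by
  refine Summable.of_nonneg_of_le (fun _ => by positivity) (fun n => ?_) summable_geometric_two
  refine pow_le_pow_of_le_one (by norm_num) (by norm_num) ?_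
  have := add_le_of_doubling h0 ha 0 n
  rw [zero_add] at this
  omega

/-- The exponents grow by at least 1 at each step, so the tail lies between its first term and a
geometric series with that first term. -/
theorem tail_bounds (h0 : 1 ≤ a 0) (ha : ∀ n, 2 * a n ≤ a (n + 1)) (n : ℕ) :
    (1 / 2 : ℝ) ^ a n ≤ ∑' i, (1 / 2 : ℝ) ^ a i - ∑ i ∈ Finset.range n, (1 / 2 : ℝ) ^ a i ∧
    ∑' i, (1 / 2 : ℝ) ^ a i - ∑ i ∈ Finset.range n, (1 / 2 : ℝ) ^ a i ≤ 2 * (1 / 2 : ℝ) ^ a n := by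
  have hs := summable_of_doubling h0 ha
  have hs' : Summable fun i => (1 / 2 : ℝ) ^ a (i + n) := (summable_nat_add_iff n).2 hs
  have heq : ∑' i, (1 / 2 : ℝ) ^ a i - ∑ i ∈ Finset.range n, (1 / 2 : ℝ) ^ a i
      = ∑' i, (1 / 2 : ℝ) ^ a (i + n) := by
    rw [← hs.sum_add_tsum_nat_add n]; ring
  rw [heq]
  constructor
  · have := hs'.le_tsum 0 (fun _ _ => by positivity)
    simpa using this
  · have hg : Summable fun i : ℕ => (1 / 2 : ℝ) ^ a n * (1 / 2 : ℝ) ^ i :=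
      summable_geometric_two.mul_left _
    have := hs'.tsum_le_tsum (fun i => ?_) hg
    · rw [tsum_mul_left, tsum_geometric_two] at this
      linarith
    · rw [← pow_add, add_comm i n]
      exact pow_le_pow_of_le_one (by norm_num) (by norm_num) (add_le_of_doubling h0 ha n i)

theorem tendsto_partialSum_of_doubling (h0 : 1 ≤ a 0) (ha : ∀ n, 2 * a n ≤ a (n + 1)) :
    Tendsto (fun n => ∑ i ∈ Finset.range n, (1 / 2 : ℝ) ^ a i) atTop
      (𝓝 (∑' i, (1 / 2 : ℝ) ^ a i)) :=
  (summable_of_doubling h0 ha).hasSum.tendsto_sum_nat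

theorem monotone_of_doubling (ha : ∀ n, 2 * a n ≤ a (n + 1)) : Monotone a :=
  monotone_nat_of_le_succ fun n => by have := ha n; omega

/-- The truncations of a lacunary binary series with exponents close to a geometric progression of
ratio `L`. -/
theorem isApproxSeq_of_doubling {L : ℝ} (h0 : 1 ≤ a 0) (ha : ∀ n, 2 * a n ≤ a (n + 1))
    (hup : ∀ n, (a (n + 1) : ℝ) ≤ L * a n + L) (hlo : ∀ n, L * a n - 1 ≤ (a (n + 1) : ℝ)) :
    IsApproxSeq L (∑' i, (1 / 2 : ℝ) ^ a i)
      (fun n => ∑ i ∈ Finset.range (n + 1), (2 : ℤ) ^ (a n - a i)) (fun n => 2 ^ a n) := by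
  have hmono := monotone_of_doubling ha
  have hdiv : ∀ n, ((∑ i ∈ Finset.range (n + 1), (2 : ℤ) ^ (a n - a i) : ℤ) : ℝ) /
      ((2 ^ a n : ℕ) : ℝ) = ∑ i ∈ Finset.range (n + 1), (1 / 2 : ℝ) ^ a i := by
    intro n
    push_cast
    rw [Finset.sum_div]
    refine Finset.sum_congr rfl fun i hi => ?_
    have hle : a i ≤ a n := hmono (by have := Finset.mem_range.1 hi; omega)
    rw [pow_sub₀ _ two_ne_zero hle, one_div, inv_pow]
    field_simp
  have hqL : ∀ n, (((2 ^ a n : ℕ) : ℝ)) ^ (-L) = (2 : ℝ) ^ (-(L * a n)) := by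
    intro n
    push_cast
    rw [← Real.rpow_natCast, ← Real.rpow_mul two_pos.le]
    congr 1; ring
  have hhalf : ∀ n, (1 / 2 : ℝ) ^ a n = (2 : ℝ) ^ (-(a n : ℝ)) := by
    intro n
    rw [Real.rpow_neg two_pos.le, Real.rpow_natCast, one_div, inv_pow]
  -- Since `a (n + 1)` lies between `L * a n - 1` and `L * a n + L`, the upper estimate loses `2 * 2
  -- = 4` and the other two lose `2 ^ L`.
  refine ⟨fun n => ?_, ?_, 2 ^ L + 4, by positivity, Eventually.of_forall fun n => ?_⟩
  · push_cast
    refine IsCoprime.pow_right ?_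
    rw [Finset.sum_range_succ, Nat.sub_self, pow_zero]
    -- The last summand of the numerator is 1 and all others are even, so the fraction is reduced.
    have hdvd : (2 : ℤ) ∣ ∑ i ∈ Finset.range n, (2 : ℤ) ^ (a n - a i) := by
      refine Finset.dvd_sum fun i hi => dvd_pow_self _ ?_
      have hi := Finset.mem_range.1 hi
      have h1 := add_le_of_doubling h0 ha i (n - i)
      rw [Nat.add_sub_cancel' hi.le] at h1
      omega
    obtain ⟨c, hc⟩ := hdvd
    rw [hc]
    exact ⟨1, -c, by ring⟩
  · refine (tendsto_pow_atTop_atTop_of_one_lt one_lt_two).comp ?_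
    refine tendsto_atTop_mono (fun n => ?_) tendsto_id
    have := add_le_of_doubling h0 ha 0 n
    rw [zero_add] at this
    simp only [id]
    omega
  · have htail := tail_bounds h0 ha (n + 1)
    have h2L : (0 : ℝ) < 2 ^ L := by positivity
    rw [hdiv, abs_sub_comm, abs_of_nonneg (le_trans (by positivity) htail.1), hqL]
    rw [hhalf] at htail
    have hu : (2 : ℝ) ^ (-(a (n + 1) : ℝ)) ≤ 2 * 2 ^ (-(L * a n)) := by
      calc (2 : ℝ) ^ (-(a (n + 1) : ℝ)) ≤ 2 ^ (1 + -(L * a n)) :=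
            Real.rpow_le_rpow_of_exponent_le one_le_two (by linarith [hlo n])
        _ = _ := by rw [Real.rpow_add two_pos, Real.rpow_one]
    have hl : (2 : ℝ) ^ (-(L * a n)) ≤ 2 ^ L * 2 ^ (-(a (n + 1) : ℝ)) := by
      rw [← Real.rpow_add two_pos]
      exact Real.rpow_le_rpow_of_exponent_le one_le_two (by linarith [hup n])
    refine ⟨?_, ?_, ?_⟩
    · have : 0 < 2 ^ L * (2 : ℝ) ^ (-(L * a n)) := by positivity
      linarith [htail.2]
    · have h3 : (0 : ℝ) < 2 ^ (-(a (n + 1) : ℝ)) := by positivity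
      refine hl.trans (mul_le_mul (by linarith) htail.1 h3.le (by positivity))
    · push_cast
      rw [← Real.rpow_natCast, ← Real.rpow_natCast 2 (a n), ← Real.rpow_mul two_pos.le]
      have h4 : (2 : ℝ) ^ (a (n + 1) : ℝ) ≤ 2 ^ L * 2 ^ (a n * L : ℝ) := by
        rw [← Real.rpow_add two_pos]
        exact Real.rpow_le_rpow_of_exponent_le one_le_two (by linarith [hup n])
      have : (0 : ℝ) < 2 ^ (a n * L : ℝ) := by positivity
      linarith

end Lacunary

/-! ### The exponents of `binaryNumber` -/

theorem two_mul_floor_pow_le {L : ℝ} (hL : 2 ≤ L) (n : ℕ) : 2 * ⌊L ^ n⌋₊ ≤ ⌊L ^ (n + 1)⌋₊ := by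
  refine Nat.le_floor ?_
  push_cast
  have := Nat.floor_le (show 0 ≤ L ^ n by positivity)
  rw [pow_succ']
  have : (0 : ℝ) ≤ L ^ n := by positivity
  nlinarith

theorem two_le_coe_iff {l : ℝ} : (2 : EReal) ≤ (l : EReal) ↔ 2 ≤ l :=
  EReal.coe_le_coe_iff (x := 2)

/-- Doubling is claimed only from index 1 on, because `0! = 1!`. -/
theorem binaryExponent_doubling {k : ℕ} (hk : 1 ≤ k) {l : EReal} (hl : 2 ≤ l) (n : ℕ) :
    1 ≤ binaryExponent k l n ∧ 2 * binaryExponent k l (n + 1) ≤ binaryExponent k l (n + 1 + 1) := by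
  rcases eq_or_ne l ⊤ with rfl | hne
  · simp only [binaryExponent, if_true]
    refine ⟨Nat.factorial_pos n, ?_⟩
    rw [Nat.factorial_succ (n + 1)]
    exact Nat.mul_le_mul_right _ (by omega)
  · have hk' : (1 : ℝ) ≤ k := by exact_mod_cast hk
    have hl' : 2 ≤ l.toReal := by
      have hbot : l ≠ ⊥ := fun h => EReal.coe_ne_bot 2 (le_bot_iff.1 (h ▸ hl))
      lift l to ℝ using ⟨hne, hbot⟩
      exact two_le_coe_iff.1 hl
    simp only [binaryExponent, if_neg hne]
    refine ⟨Nat.le_floor ?_, two_mul_floor_pow_le (by nlinarith) _⟩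
    exact_mod_cast one_le_pow₀ (show 1 ≤ (k : ℝ) * (l.toReal + 1) by nlinarith)

theorem isApproxSeq_binaryNumber {k : ℕ} (hk : 1 ≤ k) {l : ℝ} (hl : 2 ≤ l) :
    ∃ p q, IsApproxSeq (k * (l + 1)) (binaryNumber k l) p q := by
  have hk' : (1 : ℝ) ≤ k := by exact_mod_cast hk
  have hL : 2 ≤ (k : ℝ) * (l + 1) := by nlinarith
  have hdef : ∀ n, binaryExponent k l n = ⌊((k : ℝ) * (l + 1)) ^ n⌋₊ := fun n => by
    simp [binaryExponent]
  have hl' : (2 : EReal) ≤ (l : EReal) := two_le_coe_iff.2 hl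
  refine ⟨_, _, isApproxSeq_of_doubling (a := fun n => binaryExponent k l (n + 1))
    (binaryExponent_doubling hk hl' 1).1 (fun n => (binaryExponent_doubling hk hl' n).2)
    (fun n => ?_) (fun n => ?_)⟩
  all_goals
    simp only [hdef]
    set L := (k : ℝ) * (l + 1)
    have h1 := Nat.floor_le (show 0 ≤ L ^ (n + 1) by positivity)
    have h2 := Nat.lt_floor_add_one (L ^ (n + 1))
    have h3 := Nat.floor_le (show 0 ≤ L ^ (n + 1 + 1) by positivity)
    have h4 := Nat.lt_floor_add_one (L ^ (n + 1 + 1))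
    have h5 : L ^ (n + 1 + 1) = L * L ^ (n + 1) := pow_succ' _ _
    nlinarith

theorem liouville_binaryNumber_top (k : ℕ) : Liouville (binaryNumber k ⊤) := by
  have h : Liouville (liouvilleNumber (2 : ℕ)) := liouville_liouvilleNumber le_rfl
  rw [← forall_liouvilleWith_iff] at h ⊢
  intro p
  -- `liouvilleNumber` also contains the term of index 0, equal to `1 / 2`.
  have heq : binaryNumber k ⊤ = liouvilleNumber (2 : ℕ) - ((1 / 2 : ℚ) : ℝ) := by
    have hs := LiouvilleNumber.summable (m := ((2 : ℕ) : ℝ)) (by norm_num)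
    rw [liouvilleNumber, hs.tsum_eq_zero_add, binaryNumber]
    simp [binaryExponent]
  rw [heq]
  exact (h p).sub_rat _

/-! ### Small signed sums of powers of `1 / 2` -/

section FiniteSums

variable {T : Type*} [Fintype T] (c : T → ℤ) (v : T → ℕ)

/-- If a finite signed sum of powers `2 ^ (-v)` is tiny and no exponent lies just after `u`, then
the part of the sum with exponents up to `u` vanishes. -/
theorem sum_filter_eq_zero_of_gap {g u : ℕ} {E : ℝ}
    (hE : |∑ t, (c t : ℝ) * (1 / 2) ^ v t| ≤ E) (hgap : ∀ t, v t ≤ u ∨ u + g < v t)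
    (hsmall : E + (∑ t, |(c t : ℝ)|) * (1 / 2) ^ (u + g) < (1 / 2) ^ u) :
    ∑ t with v t ≤ u, (c t : ℝ) * (1 / 2) ^ v t = 0 := by
  set S := ∑ t with v t ≤ u, (c t : ℝ) * (1 / 2) ^ v t with hS
  have hsplit : ∑ t, (c t : ℝ) * (1 / 2) ^ v t = S + ∑ t with ¬ v t ≤ u, (c t : ℝ) * (1 / 2) ^ v t :=
    (Finset.sum_filter_add_sum_filter_not _ _ _).symm
  have htail : |∑ t with ¬ v t ≤ u, (c t : ℝ) * (1 / 2) ^ v t| ≤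
      (∑ t, |(c t : ℝ)|) * (1 / 2) ^ (u + g) := by
    refine (Finset.abs_sum_le_sum_abs _ _).trans ?_
    rw [Finset.sum_mul]
    refine (Finset.sum_le_sum fun t ht => ?_).trans
      (Finset.sum_le_univ_sum_of_nonneg fun t => by positivity)
    rw [abs_mul, abs_of_pos (by positivity : (0 : ℝ) < (1 / 2) ^ v t)]
    refine mul_le_mul_of_nonneg_left ?_ (abs_nonneg _)
    refine pow_le_pow_of_le_one (by norm_num) (by norm_num) ?_
    have := (Finset.mem_filter.1 ht).2
    rcases hgap t with h | h <;> omega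
  have hlt : |S| < (1 / 2) ^ u := by
    have h1 : S = ∑ t, (c t : ℝ) * (1 / 2) ^ v t - ∑ t with ¬ v t ≤ u, (c t : ℝ) * (1 / 2) ^ v t := by
      rw [hsplit]; ring
    rw [h1]
    exact ((abs_sub _ _).trans (add_le_add hE htail)).trans_lt hsmall
  -- `2 ^ u * S` is an integer of absolute value below 1.
  have hint : (2 : ℝ) ^ u * S = ((∑ t with v t ≤ u, c t * 2 ^ (u - v t) : ℤ) : ℝ) := by
    rw [hS, Finset.mul_sum]
    push_cast
    refine Finset.sum_congr rfl fun t ht => ?_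
    rw [pow_sub₀ _ two_ne_zero (Finset.mem_filter.1 ht).2, one_div, inv_pow]
    ring
  have hlt1 : |(2 : ℝ) ^ u * S| < 1 := by
    rw [abs_mul, abs_of_pos (by positivity : (0 : ℝ) < 2 ^ u)]
    calc (2 : ℝ) ^ u * |S| < 2 ^ u * (1 / 2) ^ u := by gcongr
      _ = 1 := by rw [← mul_pow]; norm_num
  rw [hint] at hlt1
  have hz : (∑ t with v t ≤ u, c t * 2 ^ (u - v t) : ℤ) = 0 := by
    rw [← Int.abs_lt_one_iff]; exact_mod_cast hlt1
  rw [hz, Int.cast_zero] at hint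
  exact (mul_eq_zero.1 hint).resolve_left (by positivity)

/-- Pigeonhole: among `card T + 1` disjoint windows of length `g` after `u`, one contains no
exponent. -/
theorem exists_gap {g : ℕ} (hg : 0 < g) (u : ℕ) : ∃ i ≤ Fintype.card T,
    ∀ t, v t ≤ u + i * g ∨ u + i * g + g < v t := by
  classical
  obtain ⟨i, hi, hni⟩ := Finset.exists_mem_notMem_of_card_lt_card
    (s := Finset.univ.image fun t => (v t - u - 1) / g) (t := Finset.range (Fintype.card T + 1))
    (by rw [Finset.card_range]; exact Nat.lt_succ_of_le Finset.card_image_le)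
  refine ⟨i, by have := Finset.mem_range.1 hi; omega, fun t => ?_⟩
  by_contra! h
  refine hni (Finset.mem_image.2 ⟨t, Finset.mem_univ _, ?_⟩)
  refine Nat.div_eq_of_lt_le (by omega) ?_
  rw [Nat.succ_mul]
  omega

/-- A finite signed sum of powers `2 ^ (-v)` cannot be tiny if around some exponent all
coefficients agree. -/
theorem not_abs_sum_le_of_cluster {g H : ℕ} {E : ℝ} {c₀ : ℤ} (hg : 0 < g) (t₀ : T)
    (hH : (Fintype.card T + 1) * g + 1 ≤ H) (hHv : H ≤ v t₀) (hc₀ : c₀ ≠ 0)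
    (hc : ∀ t, v t₀ ≤ v t + H → v t ≤ v t₀ + H → c t = c₀)
    (hsmall : E ≤ (1 / 2) ^ (v t₀ + H + 1)) (hK : 2 * ∑ t, |(c t : ℝ)| < 2 ^ g) :
    ¬ |∑ t, (c t : ℝ) * (1 / 2) ^ v t| ≤ E := by
  intro hE
  -- One gap below `v t₀` and one at or above it, both within `H`. The partial sums up to both gaps
  -- vanish, hence so does the sum in between; there every coefficient is `c₀` and the term `t₀`
  -- occurs.
  obtain ⟨i, hi, hgi⟩ := exists_gap v hg (v t₀ - H)
  obtain ⟨j, hj, hgj⟩ := exists_gap v hg (v t₀)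
  have hig : i * g ≤ Fintype.card T * g := Nat.mul_le_mul_right g hi
  have hjg : j * g ≤ Fintype.card T * g := Nat.mul_le_mul_right g hj
  rw [Nat.succ_mul] at hH
  set u₁ := v t₀ - H + i * g with hu₁
  set u₂ := v t₀ + j * g with hu₂
  have hsm : ∀ u, u ≤ v t₀ + H →
      E + (∑ t, |(c t : ℝ)|) * (1 / 2) ^ (u + g) < (1 / 2) ^ u := by
    intro u hu
    have h1 : (1 / 2 : ℝ) ^ (v t₀ + H + 1) ≤ (1 / 2) ^ (u + 1) :=
      pow_le_pow_of_le_one (by norm_num) (by norm_num) (by omega)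
    have h2 : (∑ t, |(c t : ℝ)|) * (1 / 2) ^ (u + g) < (1 / 2) ^ (u + 1) := by
      have h3 : (2 : ℝ) ^ g * (1 / 2) ^ g = 1 := by rw [← mul_pow]; norm_num
      rw [pow_add, pow_add, pow_one]
      have h4 : (∑ t, |(c t : ℝ)|) * (1 / 2) ^ g < 1 / 2 := by
        have := mul_lt_mul_of_pos_right hK (show (0 : ℝ) < (1 / 2) ^ g by positivity)
        linarith
      have := mul_lt_mul_of_pos_left h4 (show (0 : ℝ) < (1 / 2) ^ u by positivity)
      linarith
    have h5 : (1 / 2 : ℝ) ^ u = (1 / 2) ^ (u + 1) + (1 / 2) ^ (u + 1) := by rw [pow_succ]; ring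
    linarith
  have hz₁ := sum_filter_eq_zero_of_gap c v hE hgi (hsm u₁ (by omega))
  have hz₂ := sum_filter_eq_zero_of_gap c v hE hgj (hsm u₂ (by omega))
  have hsplit := Finset.sum_filter_add_sum_filter_not (Finset.univ.filter fun t => v t ≤ u₂)
    (fun t => v t ≤ u₁) (fun t => (c t : ℝ) * (1 / 2) ^ v t)
  rw [hz₂, Finset.filter_filter, Finset.filter_filter] at hsplit
  have hf : (Finset.univ.filter fun t => v t ≤ u₂ ∧ v t ≤ u₁) =
      Finset.univ.filter fun t => v t ≤ u₁ :=
    Finset.filter_congr fun t _ => ⟨fun h => h.2, fun h => ⟨by omega, h⟩⟩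
  rw [hf, hz₁, zero_add] at hsplit
  have hcc : ∑ t with v t ≤ u₂ ∧ ¬ v t ≤ u₁, (c t : ℝ) * (1 / 2) ^ v t =
      c₀ * ∑ t with v t ≤ u₂ ∧ ¬ v t ≤ u₁, (1 / 2) ^ v t := by
    rw [Finset.mul_sum]
    refine Finset.sum_congr rfl fun t ht => ?_
    have := (Finset.mem_filter.1 ht).2
    rw [hc t (by omega) (by omega)]
  rw [hcc] at hsplit
  have hpos : 0 < ∑ t with v t ≤ u₂ ∧ ¬ v t ≤ u₁, (1 / 2 : ℝ) ^ v t := by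
    refine Finset.sum_pos (fun _ _ => by positivity) ⟨t₀, ?_⟩
    simp only [Finset.mem_filter, Finset.mem_univ, true_and]
    omega
  exact mul_ne_zero (by exact_mod_cast hc₀) hpos.ne' hsplit

end FiniteSums

/-! ### Transcendence of lacunary binary series -/

section Transcendence

variable {a : ℕ → ℕ}

theorem sum_Ico_add_le_of_doubling (ha : ∀ n, 2 * a n ≤ a (n + 1)) {m n : ℕ} (h : m ≤ n) :
    ∑ i ∈ Finset.Ico m n, a i + a m ≤ a n := by
  induction n, h using Nat.le_induction with
  | base => simp
  | succ n hn ih => rw [Finset.sum_Ico_succ_top hn]; have := ha n; omega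

/-- Subset sums of a doubling sequence are separated. -/
theorem subset_sums_separated (ha : ∀ n, 2 * a n ≤ a (n + 1)) {N : ℕ} {B B' : Finset ℕ}
    (hB : ∀ i ∈ B, N ≤ i) (hB' : ∀ i ∈ B', N ≤ i) (hne : B ≠ B') :
    ∑ i ∈ B, a i + a N ≤ ∑ i ∈ B', a i ∨ ∑ i ∈ B', a i + a N ≤ ∑ i ∈ B, a i := by
  have aux : ∀ B B' : Finset ℕ, (∀ i ∈ B, N ≤ i) → (∀ i ∈ B', N ≤ i) → ∀ n ∈ B, n ∉ B' →
      (∀ i, n < i → (i ∈ B ↔ i ∈ B')) → ∑ i ∈ B', a i + a N ≤ ∑ i ∈ B, a i := by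
    intro B B' hB hB' n hn hn' htop
    have h1 : ∑ i ∈ B', a i = ∑ i ∈ B' with n < i, a i + ∑ i ∈ B' with ¬ n < i, a i :=
      (Finset.sum_filter_add_sum_filter_not _ _ _).symm
    have h2 : ∑ i ∈ B, a i = ∑ i ∈ B with n < i, a i + ∑ i ∈ B with ¬ n < i, a i :=
      (Finset.sum_filter_add_sum_filter_not _ _ _).symm
    have h3 : B.filter (fun i => n < i) = B'.filter fun i => n < i := by
      ext i
      simp only [Finset.mem_filter]
      constructor
      · rintro ⟨h, h'⟩; exact ⟨(htop i h').1 h, h'⟩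
      · rintro ⟨h, h'⟩; exact ⟨(htop i h').2 h, h'⟩
    have h4 : ∑ i ∈ B' with ¬ n < i, a i ≤ ∑ i ∈ Finset.Ico N n, a i := by
      refine Finset.sum_le_sum_of_subset fun i hi => ?_
      have hi := Finset.mem_filter.1 hi
      have : i ≠ n := fun h => hn' (h ▸ hi.1)
      exact Finset.mem_Ico.2 ⟨hB' i hi.1, by omega⟩
    have h5 : a n ≤ ∑ i ∈ B with ¬ n < i, a i :=
      Finset.single_le_sum (f := a) (fun _ _ => Nat.zero_le _)
        (Finset.mem_filter.2 ⟨hn, lt_irrefl n⟩)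
    have h6 := sum_Ico_add_le_of_doubling ha (hB n hn)
    rw [h1, h2, h3]
    omega
  -- The largest index `n` in exactly one of the sets decides: larger indices cancel, and smaller
  -- ones contribute at most `a N + … + a (n - 1) ≤ a n - a N`.
  have hsd : (symmDiff B B').Nonempty := by
    rw [Finset.nonempty_iff_ne_empty]
    intro h
    exact hne (symmDiff_eq_bot.1 h)
  have hmem := Finset.max'_mem _ hsd
  set n := (symmDiff B B').max' hsd with hn
  have htop : ∀ i, n < i → (i ∈ B ↔ i ∈ B') := by
    intro i hi
    by_contra hcon
    have : i ∈ symmDiff B B' := by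
      rw [Finset.mem_symmDiff]; tauto
    have := Finset.le_max' _ _ this
    omega
  rcases Finset.mem_symmDiff.1 hmem with h | h
  · exact Or.inr (aux B B' hB hB' n h.1 h.2 htop)
  · exact Or.inl (aux B' B hB' hB n h.1 h.2 fun i hi => (htop i hi).symm)

theorem eventually_mul_pow_lt_two_pow (A e : ℕ) : ∀ᶠ N : ℕ in atTop, A * N ^ e < 2 ^ N := by
  have h := (tendsto_pow_const_div_const_pow_of_one_lt e (one_lt_two (α := ℝ))).const_mul (A : ℝ)
  rw [mul_zero] at h
  filter_upwards [h.eventually_lt_const one_pos] with N hN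
  rw [← mul_div_assoc, div_lt_one (by positivity)] at hN
  exact_mod_cast hN

theorem eventually_mul_pow_lt_choose {d : ℕ} (hd : 1 ≤ d) (A : ℕ) :
    ∀ᶠ N : ℕ in atTop, A * N ^ (d - 1) < N.choose d := by
  filter_upwards [eventually_ge_atTop (2 * d), eventually_gt_atTop (A * (2 ^ d * d.factorial))]
    with N h1 h2
  have h3 : (N + 1 - d) ^ d ≤ d.factorial * N.choose d := by
    rw [← Nat.descFactorial_eq_factorial_mul_choose]
    exact Nat.pow_sub_le_descFactorial N d
  have h4 : N ^ d ≤ 2 ^ d * (N + 1 - d) ^ d := by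
    rw [← mul_pow]; exact Nat.pow_le_pow_left (by omega) d
  have h5 : N ^ d = N * N ^ (d - 1) := by rw [← pow_succ']; congr 1; omega
  have h6 : 0 < N ^ (d - 1) := by
    have : 0 < N := by omega
    positivity
  have h7 : A * (2 ^ d * d.factorial) * N ^ (d - 1) < N * N ^ (d - 1) :=
    Nat.mul_lt_mul_of_pos_right h2 h6
  have h8 : 2 ^ d * (N + 1 - d) ^ d ≤ 2 ^ d * (d.factorial * N.choose d) :=
    Nat.mul_le_mul_left _ h3
  have h9 : 2 ^ d * d.factorial * (A * N ^ (d - 1)) < 2 ^ d * d.factorial * N.choose d := by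
    calc _ = A * (2 ^ d * d.factorial) * N ^ (d - 1) := by ring
      _ < N * N ^ (d - 1) := h7
      _ ≤ _ := by rw [← h5]; linarith
  exact lt_of_mul_lt_mul_left h9 (Nat.zero_le _)

/-- Tuples of at most `d` indices below `M`. -/
abbrev ShortTuple (d M : ℕ) : Type := Σ j : Fin d, (Fin (j : ℕ) → Fin M)

theorem card_shortTuple_le (d : ℕ) {M : ℕ} (hM : 1 ≤ M) :
    Fintype.card (ShortTuple d M) ≤ d * M ^ (d - 1) := by
  rw [Fintype.card_sigma]
  simp only [Fintype.card_pi, Fintype.card_fin, Finset.prod_const, Finset.card_univ]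
  refine (Finset.sum_le_card_nsmul _ _ (M ^ (d - 1)) fun j _ => ?_).trans (by simp)
  exact Nat.pow_le_pow_right hM (by omega)

/-- The sum of the `a i` over the entries of a tuple. -/
def tupleSum (a : ℕ → ℕ) {d M : ℕ} (t : ShortTuple d M) : ℕ := ∑ i, a (t.2 i)

theorem aeval_partialSum (P : Polynomial ℤ) (a : ℕ → ℕ) (M : ℕ) :
    Polynomial.aeval (∑ i ∈ Finset.range M, (1 / 2 : ℝ) ^ a i) P =
      ∑ t : ShortTuple (P.natDegree + 1) M, (P.coeff t.1 : ℝ) * (1 / 2) ^ tupleSum a t := by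
  rw [Polynomial.aeval_eq_sum_range, Fintype.sum_sigma, Finset.sum_range]
  refine Finset.sum_congr rfl fun j _ => ?_
  rw [Finset.sum_range, Fintype.sum_pow, zsmul_eq_mul, Finset.mul_sum]
  refine Finset.sum_congr rfl fun t _ => ?_
  rw [tupleSum, Finset.prod_pow_eq_pow_sum]

/-- A lacunary binary series whose exponents at least double at each step is transcendental. -/
theorem transcendental_of_doubling (h0 : 1 ≤ a 0) (ha : ∀ n, 2 * a n ≤ a (n + 1)) :
    Transcendental ℤ (∑' i, (1 / 2 : ℝ) ^ a i) := by
  rintro ⟨P, hP0, hP⟩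
  set ζ : ℝ := ∑' i, (1 / 2 : ℝ) ^ a i with hζ
  set d := P.natDegree with hd
  have hd1 : 1 ≤ d := by
    by_contra hlt
    have h1 : P.natDegree = 0 := by omega
    rw [Polynomial.eq_C_of_natDegree_eq_zero h1] at hP hP0
    have h2 := (Polynomial.aeval_C ζ (P.coeff 0)).symm.trans hP
    rw [eq_intCast, Int.cast_eq_zero] at h2
    exact hP0 (by rw [h2, Polynomial.C_0])
  have hmono := monotone_of_doubling ha
  -- the truncated sums almost annihilate the polynomial
  obtain ⟨C, hbig⟩ : ∃ C : ℕ, ∀ᶠ M in atTop,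
      |Polynomial.aeval (∑ i ∈ Finset.range M, (1 / 2 : ℝ) ^ a i) P| ≤ C * (1 / 2) ^ a M := by
    have hdiff : DifferentiableAt ℝ (fun x : ℝ => Polynomial.aeval x P) ζ :=
      (Polynomial.differentiable_aeval P).differentiableAt
    obtain ⟨D, hD, hb⟩ := hdiff.isBigO_sub.exists_pos
    obtain ⟨C, hC⟩ := exists_nat_ge (D * 2)
    refine ⟨C, ?_⟩
    filter_upwards [(tendsto_partialSum_of_doubling h0 ha).eventually hb.bound] with M hM
    rw [hP, sub_zero, Real.norm_eq_abs, Real.norm_eq_abs] at hM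
    have ht := tail_bounds h0 ha M
    rw [abs_sub_comm, abs_of_nonneg (le_trans (by positivity) ht.1)] at hM
    calc _ ≤ D * (2 * (1 / 2) ^ a M) := hM.trans (by gcongr; exact ht.2)
      _ = D * 2 * (1 / 2) ^ a M := by ring
      _ ≤ _ := by gcongr
  set cmax : ℕ := ∑ j ∈ Finset.range (d + 1), (P.coeff j).natAbs with hcmax
  -- The special tuple will have `d` indices below `2 N`. The `d + 2` further doublings up to `M`
  -- make the truncation error negligible at its exponent.
  have hM_top : Tendsto (fun N : ℕ => 2 * N + d + 2) atTop atTop :=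
    tendsto_atTop_mono (fun N => by simp only [id]; omega) tendsto_id
  obtain ⟨N, hb, hchoose, hR1, hR2, hCN, hNd⟩ := ((hM_top.eventually hbig).and
    ((eventually_mul_pow_lt_choose hd1 (d * 3 ^ (d - 1))).and
    ((eventually_mul_pow_lt_two_pow (2 * ((d + 1) * 3 ^ d + 2)) (d + 1)).and
    ((eventually_mul_pow_lt_two_pow (2 * (cmax * ((d + 1) * 3 ^ d))) d).and
    ((eventually_ge_atTop C).and (eventually_ge_atTop (d + 2))))))).exists
  set M := 2 * N + d + 2 with hM
  have hM3 : M ≤ 3 * N := by omega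
  set R := Fintype.card (ShortTuple (d + 1) M) with hR
  have hRle : R ≤ (d + 1) * 3 ^ d * N ^ d := by
    refine (card_shortTuple_le (d + 1) (by omega)).trans ?_
    rw [Nat.add_sub_cancel, mul_assoc, ← mul_pow]
    exact Nat.mul_le_mul_left _ (Nat.pow_le_pow_left hM3 d)
  set H := (R + 1) * N + 1 with hH
  have hN1 : 1 ≤ N := by omega
  have hHle : H ≤ ((d + 1) * 3 ^ d + 2) * N ^ (d + 1) := by
    have h1 : R * N ≤ (d + 1) * 3 ^ d * N ^ d * N := Nat.mul_le_mul_right N hRle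
    have h2 : N ≤ N ^ (d + 1) := Nat.le_self_pow (by omega) N
    calc H = R * N + N + 1 := by rw [hH]; ring
      _ ≤ (d + 1) * 3 ^ d * N ^ d * N + N ^ (d + 1) + N ^ (d + 1) := by omega
      _ = _ := by ring
  have h2H : 2 * H < 2 ^ N := by
    refine lt_of_le_of_lt ?_ hR1
    rw [mul_assoc]; exact Nat.mul_le_mul_left 2 hHle
  have haN : 2 ^ N ≤ a N := by
    have h1 := two_pow_mul_le_of_doubling ha 0 N
    rw [zero_add] at h1
    exact (Nat.le_mul_of_pos_right _ h0).trans h1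
  set F := (Finset.Ico N (2 * N)).powersetCard d with hF
  have hFmem : ∀ B ∈ F, (∀ i ∈ B, N ≤ i) ∧ (∀ i ∈ B, i < 2 * N) ∧ B.card = d := by
    intro B hB
    obtain ⟨h1, h2⟩ := Finset.mem_powersetCard.1 hB
    exact ⟨fun i hi => (Finset.mem_Ico.1 (h1 hi)).1, fun i hi => (Finset.mem_Ico.1 (h1 hi)).2, h2⟩
  have hFcard : F.card = N.choose d := by
    rw [hF, Finset.card_powersetCard, Nat.card_Ico]; congr 1; omega
  -- some `d`-fold subset sum is far from all shorter sums
  obtain ⟨B, hBF, hBfar⟩ : ∃ B ∈ F, ∀ t : ShortTuple d M,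
      ¬ (∑ i ∈ B, a i ≤ tupleSum a t + H ∧ tupleSum a t ≤ ∑ i ∈ B, a i + H) := by
    by_contra! hcon
    have : Nonempty (ShortTuple d M) := ⟨⟨⟨0, hd1⟩, fun i => Fin.elim0 i⟩⟩
    choose! f hf using hcon
    -- Two subset sums near the same short sum differ by at most `2 H < 2 ^ N ≤ a N`, against their
    -- separation. But there are `≫ N ^ d` subsets and only `≪ N ^ (d - 1)` short tuples.
    have hinj : Set.InjOn f F := by
      intro B hB B' hB' he
      by_contra hne
      have h1 := hf B hB
      have h2 := hf B' hB'
      rw [he] at h1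
      rcases subset_sums_separated ha (hFmem B hB).1 (hFmem B' hB').1 hne with h | h <;> omega
    have h1 : F.card ≤ Fintype.card (ShortTuple d M) :=
      Finset.card_le_card_of_injOn f (fun _ _ => Finset.mem_coe.2 (Finset.mem_univ _)) hinj
    have h2 := card_shortTuple_le d (M := M) (by omega)
    have h3 : d * M ^ (d - 1) ≤ d * 3 ^ (d - 1) * N ^ (d - 1) := by
      rw [mul_assoc, ← mul_pow]
      exact Nat.mul_le_mul_left _ (Nat.pow_le_pow_left hM3 _)
    omega
  obtain ⟨hB1, hB2, hBcard⟩ := hFmem B hBF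
  set t₀ : ShortTuple (d + 1) M := ⟨Fin.last d, fun i =>
    ⟨B.orderEmbOfFin hBcard i, lt_of_lt_of_le (hB2 _ (B.orderEmbOfFin_mem hBcard i)) (by omega)⟩⟩
    with ht₀
  have hvt₀ : tupleSum a t₀ = ∑ i ∈ B, a i := by
    have h1 : Finset.univ.map (B.orderEmbOfFin hBcard).toEmbedding = B :=
      Finset.map_orderEmbOfFin_univ B hBcard
    conv_rhs => rw [← h1, Finset.sum_map]
    rfl
  have hvle : tupleSum a t₀ ≤ d * a (2 * N) := by
    rw [hvt₀, ← hBcard, ← smul_eq_mul]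
    exact Finset.sum_le_card_nsmul _ _ _ fun i hi => hmono (hB2 i hi).le
  have hvge : a N ≤ tupleSum a t₀ := by
    have hne : B.Nonempty := Finset.card_pos.1 (by omega)
    obtain ⟨i, hi⟩ := hne
    rw [hvt₀]
    exact (hmono (hB1 i hi)).trans (Finset.single_le_sum (f := a) (fun _ _ => Nat.zero_le _) hi)
  rw [aeval_partialSum] at hb
  refine not_abs_sum_le_of_cluster (g := N) (H := H) (c₀ := P.coeff d)
    (fun t : ShortTuple (d + 1) M => P.coeff t.1) (tupleSum a) (by omega) t₀ le_rfl (by omega)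
    (Polynomial.leadingCoeff_ne_zero.2 hP0) ?_ ?_ ?_ hb
  · rintro ⟨j, t⟩ h1 h2
    -- Tuples shorter than `d` stay away from the cluster by the choice of `B`; the others carry the
    -- leading coefficient.
    by_cases hj : (j : ℕ) < d
    · exact absurd ⟨hvt₀ ▸ h1, hvt₀ ▸ h2⟩ (hBfar ⟨⟨j, hj⟩, t⟩)
    · have : (j : ℕ) = d := by omega
      simp only [this]
  · have h1 : (C : ℝ) ≤ 2 ^ N := by
      have : C ≤ 2 ^ N := hCN.trans Nat.lt_two_pow_self.le
      exact_mod_cast this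
    have h2 : tupleSum a t₀ + H + 1 + N ≤ a M := by
      have h3 := two_pow_mul_le_of_doubling ha (2 * N) (d + 2)
      have h4 : d + 2 ≤ 2 ^ (d + 2) := Nat.lt_two_pow_self.le
      have h5 : (d + 2) * a (2 * N) ≤ 2 ^ (d + 2) * a (2 * N) := Nat.mul_le_mul_right _ h4
      have h6 : a N ≤ a (2 * N) := hmono (by omega)
      have h7 : N < 2 ^ N := Nat.lt_two_pow_self
      have h8 : (d + 2) * a (2 * N) = d * a (2 * N) + 2 * a (2 * N) := by ring
      have h9 : 2 * N + (d + 2) = M := by omega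
      rw [h9] at h3
      omega
    calc (C : ℝ) * (1 / 2) ^ a M ≤ 2 ^ N * (1 / 2) ^ (tupleSum a t₀ + H + 1 + N) := by
          exact mul_le_mul h1 (pow_le_pow_of_le_one (by norm_num) (by norm_num) h2)
            (by positivity) (by positivity)
      _ = (1 / 2) ^ (tupleSum a t₀ + H + 1) * (2 * (1 / 2)) ^ N := by
          rw [pow_add _ _ N, mul_pow]; ring
      _ = _ := by norm_num
  · have h1 : ∑ t : ShortTuple (d + 1) M, (P.coeff t.1).natAbs ≤ R * cmax := by
      refine (Finset.sum_le_card_nsmul _ _ cmax fun t _ => ?_).trans (by simp [hR])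
      exact Finset.single_le_sum (f := fun j => (P.coeff j).natAbs) (fun _ _ => Nat.zero_le _)
        (Finset.mem_range.2 t.1.2)
    have h2 : R * cmax ≤ (d + 1) * 3 ^ d * N ^ d * cmax := Nat.mul_le_mul_right _ hRle
    have h3 : 2 * ∑ t : ShortTuple (d + 1) M, (P.coeff t.1).natAbs < 2 ^ N := by
      refine lt_of_le_of_lt (Nat.mul_le_mul_left 2 (h1.trans h2)) (lt_of_eq_of_lt ?_ hR2)
      ring
    have h4 : ∑ t : ShortTuple (d + 1) M, |(P.coeff t.1 : ℝ)| =
        ((∑ t : ShortTuple (d + 1) M, (P.coeff t.1).natAbs : ℕ) : ℝ) := by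
      push_cast
      exact Finset.sum_congr rfl fun t _ => by simp [Nat.cast_natAbs]
    rw [h4]
    exact_mod_cast h3

end Transcendence

theorem transcendental_binaryNumber {k : ℕ} (hk : 1 ≤ k) {l : EReal} (hl : 2 ≤ l) :
    Transcendental ℚ (binaryNumber k l) := by
  have h := transcendental_of_doubling (a := fun n => binaryExponent k l (n + 1))
    (binaryExponent_doubling hk hl 1).1 (fun n => (binaryExponent_doubling hk hl n).2)
  rw [Transcendental, ← IsFractionRing.isAlgebraic_iff ℤ ℚ ℝ]
  exact h

/-! ### Continuants and their convergents -/

/-- The continuants of a continued fraction `[0; 1, a_2, a_3, …]` with `a_n ≥ 2` for `n ≥ 2`: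
numerators `r` and denominators `s`. -/
structure IsContinuant (a r s : ℕ → ℕ) : Prop where
  r_zero : r 0 = 0
  r_one : r 1 = 1
  s_zero : s 0 = 1
  s_one : s 1 = 1
  r_rec : ∀ n, r (n + 2) = a (n + 2) * r (n + 1) + r n
  s_rec : ∀ n, s (n + 2) = a (n + 2) * s (n + 1) + s n
  two_le : ∀ n, 2 ≤ a (n + 2)

namespace IsContinuant

variable {a r s : ℕ → ℕ}

theorem s_bounds (h : IsContinuant a r s) (n : ℕ) :
    1 ≤ s n ∧ s n ≤ s (n + 1) ∧ 2 ^ n ≤ s (n + 1) := by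
  induction n with
  | zero => simp [h.s_zero, h.s_one]
  | succ n ih =>
    have h1 : s (n + 1 + 1) = a (n + 2) * s (n + 1) + s n := h.s_rec n
    have h2 : 2 * s (n + 1) ≤ a (n + 2) * s (n + 1) := Nat.mul_le_mul_right _ (h.two_le n)
    refine ⟨by omega, by omega, ?_⟩
    rw [pow_succ]
    omega

theorem s_pos (h : IsContinuant a r s) (n : ℕ) : (0 : ℝ) < s n := by
  exact_mod_cast (h.s_bounds n).1

theorem det (h : IsContinuant a r s) (n : ℕ) :
    (r (n + 1) : ℤ) * s n - r n * s (n + 1) = (-1) ^ n := by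
  induction n with
  | zero => simp [h.r_zero, h.r_one, h.s_zero]
  | succ n ih =>
    rw [h.r_rec, h.s_rec, pow_succ, ← ih]
    push_cast
    ring

theorem isCoprime (h : IsContinuant a r s) (n : ℕ) : IsCoprime (r n : ℤ) (s n : ℤ) := by
  have h1 := h.det n
  have h2 : ((-1 : ℤ) ^ n) * (-1) ^ n = 1 := by rw [← mul_pow]; norm_num
  exact ⟨-(-1) ^ n * s (n + 1), (-1) ^ n * r (n + 1), by
    linear_combination (-1 : ℤ) ^ n * h1 + h2⟩

theorem conv_succ_sub (h : IsContinuant a r s) (n : ℕ) :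
    (r (n + 1) : ℝ) / s (n + 1) - r n / s n = (-1) ^ n / (s n * s (n + 1)) := by
  have h1 : (r (n + 1) : ℝ) * s n - r n * s (n + 1) = (-1) ^ n := by exact_mod_cast h.det n
  have h2 := (h.s_pos n).ne'
  have h3 := (h.s_pos (n + 1)).ne'
  rw [← h1]
  field_simp

/-- The sign `(-1) ^ n` makes even convergents increase and odd ones decrease, which places the
limit between neighbours. -/
theorem conv_add_two_sub (h : IsContinuant a r s) (n : ℕ) :
    (r (n + 2) : ℝ) / s (n + 2) - r n / s n = (-1) ^ n * (a (n + 2) / (s n * s (n + 2))) := by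
  have h1 := h.conv_succ_sub n
  have h2 := h.conv_succ_sub (n + 1)
  have h3 := (h.s_pos n).ne'
  have h4 := (h.s_pos (n + 1)).ne'
  have h5 := (h.s_pos (n + 1 + 1)).ne'
  have h6 : (s (n + 1 + 1) : ℝ) = a (n + 2) * s (n + 1) + s n := by exact_mod_cast h.s_rec n
  have h7 : (-1 : ℝ) ^ (n + 1) / (s (n + 1) * s (n + 1 + 1)) + (-1) ^ n / (s n * s (n + 1)) =
      (-1) ^ n * (a (n + 2) / (s n * s (n + 1 + 1))) := by
    field_simp
    rw [h6]
    ring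
  rw [← h7, ← h1, ← h2]
  ring

theorem exists_tendsto (h : IsContinuant a r s) :
    ∃ ζ : ℝ, Tendsto (fun n => (r n : ℝ) / s n) atTop (𝓝 ζ) := by
  refine cauchySeq_tendsto_of_complete (cauchySeq_of_le_geometric (1 / 2) 1 (by norm_num) fun n => ?_)
  rw [dist_comm, Real.dist_eq, h.conv_succ_sub, abs_div, abs_pow, abs_neg, abs_one, one_pow,
    abs_of_pos (mul_pos (h.s_pos _) (h.s_pos _)), one_mul, one_div, one_div, inv_pow]
  have h1 : (1 : ℝ) ≤ s n := by exact_mod_cast (h.s_bounds n).1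
  have h2 : (2 : ℝ) ^ n ≤ s (n + 1) := by exact_mod_cast (h.s_bounds n).2.2
  gcongr
  nlinarith [h.s_pos (n + 1)]

variable {ζ : ℝ}

theorem alternating_nonneg (h : IsContinuant a r s)
    (hζ : Tendsto (fun n => (r n : ℝ) / s n) atTop (𝓝 ζ)) (n : ℕ) :
    0 ≤ (-1) ^ n * (ζ - r n / s n) := by
  have h1 : ∀ m, 0 ≤ (-1 : ℝ) ^ n * (r (n + 2 * m) / s (n + 2 * m) - r n / s n) := by
    intro m
    induction m with
    | zero => simp
    | succ m ih =>
      have h2 := h.conv_add_two_sub (n + 2 * m)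
      have h3 : (-1 : ℝ) ^ (n + 2 * m) = (-1) ^ n := by rw [pow_add, pow_mul]; norm_num
      have h4 : ((-1 : ℝ) ^ n) * (-1) ^ n = 1 := by rw [← mul_pow]; norm_num
      have h5 : (0 : ℝ) ≤ a (n + 2 * m + 2) / (s (n + 2 * m) * s (n + 2 * m + 2)) := by positivity
      rw [h3] at h2
      have h6 : (-1 : ℝ) ^ n * (r (n + 2 * m + 2) / s (n + 2 * m + 2) - r n / s n) =
          (-1) ^ n * (-1) ^ n * (a (n + 2 * m + 2) / (s (n + 2 * m) * s (n + 2 * m + 2))) +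
          (-1) ^ n * (r (n + 2 * m) / s (n + 2 * m) - r n / s n) := by
        rw [mul_assoc, ← h2]; ring
      rw [show n + 2 * (m + 1) = n + 2 * m + 2 by ring, h6, h4]
      linarith
  have hsub : Tendsto (fun m : ℕ => n + 2 * m) atTop atTop :=
    tendsto_atTop_mono (fun m => by simp only [id]; omega) tendsto_id
  exact ge_of_tendsto' (((hζ.comp hsub).sub_const _).const_mul _) h1

theorem abs_sub_eq (h : IsContinuant a r s)
    (hζ : Tendsto (fun n => (r n : ℝ) / s n) atTop (𝓝 ζ)) (n : ℕ) :
    |(r n : ℝ) / s n - ζ| = (-1) ^ n * (ζ - r n / s n) := by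
  rw [abs_sub_comm, ← abs_of_nonneg (h.alternating_nonneg hζ n), abs_mul, abs_pow, abs_neg,
    abs_one, one_pow, one_mul]

theorem abs_sub_le (h : IsContinuant a r s)
    (hζ : Tendsto (fun n => (r n : ℝ) / s n) atTop (𝓝 ζ)) (n : ℕ) :
    |(r n : ℝ) / s n - ζ| ≤ 1 / (s n * s (n + 1)) := by
  have h1 := h.alternating_nonneg hζ (n + 1)
  have h2 := h.conv_succ_sub n
  have h4 : ((-1 : ℝ) ^ n) * (-1) ^ n = 1 := by rw [← mul_pow]; norm_num
  rw [h.abs_sub_eq hζ]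
  have h5 : (-1 : ℝ) ^ n * (ζ - r n / s n) = (-1) ^ n * ((-1) ^ n / (s n * s (n + 1))) -
      (-1) ^ (n + 1) * (ζ - r (n + 1) / s (n + 1)) := by
    rw [← h2, pow_succ]; ring
  rw [h5, ← mul_div_assoc, h4]
  linarith

theorem le_abs_sub (h : IsContinuant a r s)
    (hζ : Tendsto (fun n => (r n : ℝ) / s n) atTop (𝓝 ζ)) (n : ℕ) :
    (a (n + 2) : ℝ) / (s n * s (n + 2)) ≤ |(r n : ℝ) / s n - ζ| := by
  have h1 := h.alternating_nonneg hζ (n + 2)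
  have h2 := h.conv_add_two_sub n
  have h4 : ((-1 : ℝ) ^ n) * (-1) ^ n = 1 := by rw [← mul_pow]; norm_num
  rw [h.abs_sub_eq hζ]
  have h5 : (-1 : ℝ) ^ n * (ζ - r n / s n) = (-1) ^ n * (-1) ^ n * (a (n + 2) / (s n * s (n + 2))) +
      (-1) ^ (n + 2) * (ζ - r (n + 2) / s (n + 2)) := by
    rw [mul_assoc, ← h2, pow_add]; ring
  rw [h5, h4]
  linarith

/-- The convergent of index `n + 2` lies between that of index `n` and the limit. The strict
inequality is what separates different `ε` later. -/
theorem lt_abs_sub (h : IsContinuant a r s)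
    (hζ : Tendsto (fun n => (r n : ℝ) / s n) atTop (𝓝 ζ)) (n : ℕ) :
    1 / ((s n : ℝ) * (s (n + 1) + s n)) < |(r n : ℝ) / s n - ζ| := by
  refine lt_of_lt_of_le ?_ (h.le_abs_sub hζ n)
  have h0 := h.s_pos n
  have h1 := h.s_pos (n + 1)
  have h2 := h.s_pos (n + 2)
  have h3 : (s (n + 2) : ℝ) = a (n + 2) * s (n + 1) + s n := by exact_mod_cast h.s_rec n
  have h4 : (2 : ℝ) ≤ a (n + 2) := by exact_mod_cast h.two_le n
  rw [div_lt_div_iff₀ (by positivity) (by positivity), one_mul]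
  have h5 : (s (n + 2) : ℝ) < a (n + 2) * (s (n + 1) + s n) := by nlinarith
  nlinarith

theorem tendsto_s (h : IsContinuant a r s) : Tendsto s atTop atTop := by
  rw [← tendsto_add_atTop_iff_nat 1]
  exact tendsto_atTop_mono (fun n => (h.s_bounds n).2.2)
    (tendsto_pow_atTop_atTop_of_one_lt one_lt_two)

end IsContinuant

/-! ### The continued fractions `cfFraction` -/

/-- The numerators of the convergents of `cfFraction k l ε`. -/
noncomputable def cfNumer (k : ℕ) (l : ℝ) (ε : ℕ → Fin 2) : ℕ → ℕ
  | 0 => 0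
  | 1 => 1
  | n + 2 => cfQuot k l ε (n + 2) * cfNumer k l ε (n + 1) + cfNumer k l ε n

section

variable {k : ℕ} {l : ℝ}

theorem cfDen_rec (k : ℕ) (l : ℝ) (ε : ℕ → Fin 2) (n : ℕ) :
    cfDen k l ε (n + 2) = cfQuot k l ε (n + 2) * cfDen k l ε (n + 1) + cfDen k l ε n := by
  cases n with
  | zero => simp [cfDen, cfQuot]
  | succ n => simp [cfDen, cfQuot]

theorem cfNumer_rec (k : ℕ) (l : ℝ) (ε : ℕ → Fin 2) (n : ℕ) :
    cfNumer k l ε (n + 2) = cfQuot k l ε (n + 2) * cfNumer k l ε (n + 1) + cfNumer k l ε n := by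
  rw [cfNumer]

theorem three_le_cfDen (k : ℕ) (l : ℝ) (ε : ℕ → Fin 2) (n : ℕ) : 3 ≤ cfDen k l ε (n + 2) := by
  induction n with
  | zero => simp [cfDen]
  | succ n ih =>
    have h1 : 1 ≤ ⌈(cfDen k l ε (n + 2) : ℝ) ^ ((k : ℝ) * l + k - 2)⌉₊ := by
      rw [Nat.one_le_ceil_iff]
      exact Real.rpow_pos_of_pos (by exact_mod_cast (by omega : 0 < cfDen k l ε (n + 2))) _
    rw [show n + 1 + 2 = n + 3 by ring, cfDen]
    nlinarith

theorem isContinuant_cf (hk : 1 ≤ k) (hl : 2 ≤ l) (ε : ℕ → Fin 2) :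
    IsContinuant (cfQuot k l ε) (cfNumer k l ε) (cfDen k l ε) where
  r_zero := by simp [cfNumer]
  r_one := by simp [cfNumer]
  s_zero := by simp [cfDen]
  s_one := by simp [cfDen]
  r_rec n := cfNumer_rec k l ε n
  s_rec n := cfDen_rec k l ε n
  two_le n := by
    cases n with
    | zero => simp [cfQuot]
    | succ n =>
      have hk' : (1 : ℝ) ≤ k := by exact_mod_cast hk
      have h3 : (3 : ℝ) ≤ cfDen k l ε (n + 2) := by exact_mod_cast three_le_cfDen k l ε n
      have h1 : (3 : ℝ) ≤ (cfDen k l ε (n + 2) : ℝ) ^ ((k : ℝ) * l + k - 2) :=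
        h3.trans (Real.self_le_rpow_of_one_le (by linarith) (by nlinarith))
      have h2 : (3 : ℝ) ≤ ⌈(cfDen k l ε (n + 2) : ℝ) ^ ((k : ℝ) * l + k - 2)⌉₊ :=
        h1.trans (Nat.le_ceil _)
      have h2 : 3 ≤ ⌈(cfDen k l ε (n + 2) : ℝ) ^ ((k : ℝ) * l + k - 2)⌉₊ := by exact_mod_cast h2
      rw [show n + 1 + 2 = n + 3 by ring, cfQuot]
      omega

theorem cfFraction_nums (k : ℕ) (l : ℝ) (ε : ℕ → Fin 2) (n : ℕ) :
    (cfFraction k l ε).nums n = (cfNumer k l ε n : ℝ) := by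
  have h : ∀ n, (cfFraction k l ε).nums n = (cfNumer k l ε n : ℝ) ∧
      (cfFraction k l ε).nums (n + 1) = (cfNumer k l ε (n + 1) : ℝ) := by
    intro n
    induction n with
    | zero =>
      refine ⟨by simp [cfNumer, cfFraction, cfQuot], ?_⟩
      rw [GenContFract.first_num_eq (cfFraction_get k l ε 0)]
      simp [cfNumer, cfQuot, cfFraction]
    | succ n ih =>
      refine ⟨ih.2, ?_⟩
      rw [GenContFract.nums_recurrence (cfFraction_get k l ε (n + 1)) ih.1 ih.2]
      simp [cfNumer]
  exact (h n).1

theorem cfFraction_convs (k : ℕ) (l : ℝ) (ε : ℕ → Fin 2) :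
    (cfFraction k l ε).convs = fun n => (cfNumer k l ε n : ℝ) / cfDen k l ε n := by
  funext n
  rw [GenContFract.conv_eq_num_div_den, cfFraction_nums, cfFraction_dens]

theorem tendsto_cfFraction_convs (hk : 1 ≤ k) (hl : 2 ≤ l) (ε : ℕ → Fin 2) :
    Tendsto (cfFraction k l ε).convs atTop (𝓝 (cfNumber k l ε)) := by
  refine tendsto_nhds_limUnder ?_
  rw [cfFraction_convs]
  exact (isContinuant_cf hk hl ε).exists_tendsto

theorem tendsto_cfNumber (hk : 1 ≤ k) (hl : 2 ≤ l) (ε : ℕ → Fin 2) :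
    Tendsto (fun n => (cfNumer k l ε n : ℝ) / cfDen k l ε n) atTop (𝓝 (cfNumber k l ε)) := by
  rw [← cfFraction_convs]
  exact tendsto_cfFraction_convs hk hl ε

/-- The exponent `k l + k - 2` is `L - 2`. Rounding up, adding `ε` and adding the previous
denominator each cost at most one more copy of the main term, whence 4. -/
theorem cfDen_growth (hk : 1 ≤ k) (hl : 2 ≤ l) (ε : ℕ → Fin 2) (n : ℕ) :
    (cfDen k l ε (n + 2) : ℝ) ^ (k * (l + 1) - 1) ≤ cfDen k l ε (n + 3) ∧
    (cfDen k l ε (n + 3) : ℝ) ≤ 4 * (cfDen k l ε (n + 2) : ℝ) ^ (k * (l + 1) - 1) := by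
  have hk' : (1 : ℝ) ≤ k := by exact_mod_cast hk
  have hle : (cfDen k l ε (n + 1) : ℝ) ≤ cfDen k l ε (n + 2) := by
    exact_mod_cast ((isContinuant_cf hk hl ε).s_bounds (n + 1)).2.1
  have h3 : (3 : ℝ) ≤ cfDen k l ε (n + 2) := by exact_mod_cast three_le_cfDen k l ε n
  have hε : ((ε n : ℕ) : ℝ) ≤ 1 := by exact_mod_cast (by omega : (ε n : ℕ) ≤ 1)
  have hε0 : (0 : ℝ) ≤ ((ε n : ℕ) : ℝ) := Nat.cast_nonneg _
  have hd0 : (0 : ℝ) ≤ (cfDen k l ε (n + 1) : ℝ) := Nat.cast_nonneg _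
  rw [cfDen]
  push_cast
  set S := (cfDen k l ε (n + 2) : ℝ)
  have hS : 0 < S := by linarith
  have h1 := Nat.le_ceil (S ^ ((k : ℝ) * l + k - 2))
  have h2 := Nat.ceil_lt_add_one (show 0 ≤ S ^ ((k : ℝ) * l + k - 2) by positivity)
  have h4 : S ^ ((k : ℝ) * (l + 1) - 1) = S ^ ((k : ℝ) * l + k - 2) * S := by
    rw [← Real.rpow_add_one hS.ne']; congr 1; ring
  have h5 : 1 ≤ S ^ ((k : ℝ) * l + k - 2) := Real.one_le_rpow (by linarith) (by nlinarith)
  rw [h4]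
  constructor <;> nlinarith

theorem isApproxSeq_cfNumber (hk : 1 ≤ k) (hl : 2 ≤ l) (ε : ℕ → Fin 2) :
    IsApproxSeq (k * (l + 1)) (cfNumber k l ε) (fun n => (cfNumer k l ε n : ℤ)) (cfDen k l ε) := by
  have h := isContinuant_cf hk hl ε
  have hζ := tendsto_cfNumber hk hl ε
  -- With `W = S ^ (L - 1)`, the lower bound involves `S' + S ≤ 2 S' ≤ 8 W`.
  refine ⟨h.isCoprime, h.tendsto_s, 8, by norm_num, ?_⟩
  filter_upwards [eventually_ge_atTop 2] with n hn
  obtain ⟨n, rfl⟩ := Nat.exists_eq_add_of_le' hn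
  obtain ⟨h1, h2⟩ := cfDen_growth hk hl ε n
  have h3 := h.abs_sub_le hζ (n + 2)
  have h4 := (h.lt_abs_sub hζ (n + 2)).le
  have h5 := h.s_pos (n + 2)
  have h6 : (cfDen k l ε (n + 2) : ℝ) ≤ cfDen k l ε (n + 3) := by
    exact_mod_cast (h.s_bounds (n + 2)).2.1
  have h7 : (1 : ℝ) ≤ cfDen k l ε (n + 2) := by exact_mod_cast (h.s_bounds (n + 2)).1
  simp only [Int.cast_natCast]
  rw [show n + 2 + 1 = n + 3 by ring] at h3 h4 ⊢
  set S := (cfDen k l ε (n + 2) : ℝ)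
  set S' := (cfDen k l ε (n + 3) : ℝ)
  set L : ℝ := k * (l + 1) with hL
  set W := S ^ (L - 1) with hW
  have hW0 : 0 < W := by positivity
  have hSL : S ^ L = S * W := by
    rw [hW, mul_comm, ← Real.rpow_add_one h5.ne']; congr 1; ring
  rw [Real.rpow_neg h5.le, hSL]
  refine ⟨?_, ?_, ?_⟩
  · refine h3.trans ?_
    rw [one_div]
    have : (S * S')⁻¹ ≤ (S * W)⁻¹ := by gcongr
    have : 0 < (S * W)⁻¹ := by positivity
    linarith
  · have h8 : 1 / (8 * (S * W)) ≤ 1 / (S * (S' + S)) := by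
      refine one_div_le_one_div_of_le (by positivity) ?_
      nlinarith
    have h9 : (S * W)⁻¹ = 8 * (1 / (8 * (S * W))) := by field_simp
    rw [h9]
    exact mul_le_mul_of_nonneg_left (h8.trans h4) (by norm_num)
  · nlinarith

/-! ### Dependence on `ε` -/

theorem cf_congr {ε ε' : ℕ → Fin 2} {n : ℕ} (h : ∀ i < n, ε i = ε' i) (j : ℕ) (hj : j < n + 3) :
    cfQuot k l ε j = cfQuot k l ε' j ∧ cfDen k l ε j = cfDen k l ε' j ∧
      cfNumer k l ε j = cfNumer k l ε' j := by
  induction j using Nat.strong_induction_on with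
  | _ j ih =>
    match j, hj, ih with
    | 0, _, _ => simp [cfQuot, cfDen, cfNumer]
    | 1, _, _ => simp [cfQuot, cfDen, cfNumer]
    | 2, _, _ => simp [cfQuot, cfDen, cfNumer]
    | m + 3, hj, ih =>
      have h1 := ih (m + 1) (by omega) (by omega)
      have h2 := ih (m + 2) (by omega) (by omega)
      have hq : cfQuot k l ε (m + 3) = cfQuot k l ε' (m + 3) := by
        rw [cfQuot, cfQuot, h2.2.1, h m (by omega)]
      refine ⟨hq, ?_, ?_⟩
      · rw [cfDen_rec k l ε (m + 1), cfDen_rec k l ε' (m + 1), h1.2.1, h2.2.1, hq]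
      · rw [cfNumer_rec k l ε (m + 1), cfNumer_rec k l ε' (m + 1), h1.2.2, h2.2.2, hq]

/-- Up to index `n + 2` the convergents agree, and the next denominators differ by exactly
`s_{n+2}`. So the upper bound for the distance of the second number from the common convergent
equals the strict lower bound for the first. -/
theorem cfNumber_ne {ε ε' : ℕ → Fin 2} (hk : 1 ≤ k) (hl : 2 ≤ l) {n : ℕ}
    (h : ∀ i < n, ε i = ε' i) (h0 : ε n = 0) (h1 : ε' n = 1) :
    cfNumber k l ε ≠ cfNumber k l ε' := by
  intro he
  have hc := cf_congr (k := k) (l := l) h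
  have h2 := (isContinuant_cf hk hl ε).lt_abs_sub (tendsto_cfNumber hk hl ε) (n + 2)
  have h3 := (isContinuant_cf hk hl ε').abs_sub_le (tendsto_cfNumber hk hl ε') (n + 2)
  have h4 : cfDen k l ε' (n + 3) = cfDen k l ε (n + 3) + cfDen k l ε (n + 2) := by
    rw [cfDen, cfDen, h0, h1, (hc (n + 2) (by omega)).2.1, (hc (n + 1) (by omega)).2.1]
    simp only [Fin.val_zero, Fin.val_one]
    ring
  rw [show n + 2 + 1 = n + 3 by ring, h4, ← he, ← (hc (n + 2) (by omega)).2.1,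
    ← (hc (n + 2) (by omega)).2.2] at h3
  rw [show n + 2 + 1 = n + 3 by ring] at h2
  push_cast at h3
  linarith

theorem cfNumber_injective (hk : 1 ≤ k) (hl : 2 ≤ l) :
    Function.Injective (cfNumber k l) := by
  intro ε ε' he
  by_contra hne
  obtain ⟨m, hm⟩ := Function.ne_iff.1 hne
  classical
  have hex : ∃ m, ε m ≠ ε' m := ⟨m, hm⟩
  have hmin : ∀ i < Nat.find hex, ε i = ε' i := fun i hi => not_not.1 (Nat.find_min hex hi)
  have hn := Nat.find_spec hex
  rcases (show (ε (Nat.find hex) = 0 ∧ ε' (Nat.find hex) = 1) ∨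
      (ε (Nat.find hex) = 1 ∧ ε' (Nat.find hex) = 0) by omega) with h | h
  · exact cfNumber_ne hk hl hmin h.1 h.2 he
  · exact cfNumber_ne hk hl (fun i hi => (hmin i hi).symm) h.2 h.1 he.symm

theorem countable_not_transcendental_cfNumber (hk : 1 ≤ k) (hl : 2 ≤ l) :
    {ε : ℕ → Fin 2 | ¬ Transcendental ℚ (cfNumber k l ε)}.Countable := by
  have h := (Algebraic.countable ℚ ℝ).preimage_of_injOn (f := cfNumber k l)
    (cfNumber_injective hk hl).injOn
  refine h.mono fun ε hε => ?_
  exact not_not.1 hε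

end

end SimApprox

theorem mainTheorem6 (k : ℕ) (hk : 1 ≤ k) :
    (∀ l : EReal, 2 ≤ l →
      Transcendental ℚ (SimApprox.binaryNumber k l) ∧
      SimApprox.chi (SimApprox.veronese k (SimApprox.binaryNumber k l)) = l ∧
      SimApprox.lambdaExp k (SimApprox.binaryNumber k l) = l) ∧
    (∀ l : ℝ, 2 ≤ l →
      (∀ ε : ℕ → Fin 2,
        Tendsto (SimApprox.cfFraction k l ε).convs atTop (𝓝 (SimApprox.cfNumber k l ε)) ∧
        SimApprox.IndepWithOne (SimApprox.veronese k (SimApprox.cfNumber k l ε)) ∧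
        SimApprox.chi (SimApprox.veronese k (SimApprox.cfNumber k l ε)) = (l : EReal) ∧
        SimApprox.lambdaExp k (SimApprox.cfNumber k l ε) = (l : EReal)) ∧
      {ε : ℕ → Fin 2 | ¬ Transcendental ℚ (SimApprox.cfNumber k l ε)}.Countable) ∧
    Set.Icc 2 ⊤ ⊆ SimApprox.veroneseSpectrum k := by
  have hbin : ∀ l : EReal, 2 ≤ l →
      SimApprox.IndepWithOne (SimApprox.veronese k (SimApprox.binaryNumber k l)) ∧
      SimApprox.chi (SimApprox.veronese k (SimApprox.binaryNumber k l)) = l ∧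
      SimApprox.lambdaExp k (SimApprox.binaryNumber k l) = l := by
    intro l hl
    rcases eq_or_ne l ⊤ with rfl | hne
    · exact SimApprox.exponents_eq_top hk (SimApprox.liouville_binaryNumber_top k)
    · have hbot : l ≠ ⊥ := fun h => EReal.coe_ne_bot 2 (le_bot_iff.1 (h ▸ hl))
      lift l to ℝ using ⟨hne, hbot⟩
      have hl' := SimApprox.two_le_coe_iff.1 hl
      obtain ⟨p, q, h⟩ := SimApprox.isApproxSeq_binaryNumber hk hl'
      exact h.exponents_eq hk hl'
  refine ⟨fun l hl => ⟨SimApprox.transcendental_binaryNumber hk hl, (hbin l hl).2⟩,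
    fun l hl => ⟨fun ε => ⟨SimApprox.tendsto_cfFraction_convs hk hl ε,
      (SimApprox.isApproxSeq_cfNumber hk hl ε).exponents_eq hk hl⟩,
      SimApprox.countable_not_transcendental_cfNumber hk hl⟩, fun l hl => ?_⟩
  exact ⟨SimApprox.binaryNumber k l, (hbin l hl.1).1, (hbin l hl.1).2.1⟩
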